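/- **Theorem (covering by cycles in a Banach space).** Let $X$ be a separable real Banach space with $\dim X\ge 2$, and let $T\in\mathbf M_1(X)$ be a one-dimensional metric current in the sense of Ambrosio and Kirchheim, i.e. a bilinear functional $(f,\pi)\mapsto T(f,\pi)$ of a bounded Lipschitz function $f$ and a Lipschitz function $\pi$ such that: (i) there is a finite Borel measure $\mu$ with $|T(f,\pi)|\le \mathrm{Lip}(\pi)\int_X|f|\,d\mu$ for all $(f,\pi)$; (ii) $T(f,\pi_j)\to T(f,\pi)$ whenever $\pi_j\to\pi$ pointwise with $\sup_j\mathrm{Lip}(\pi_j)<\infty$; (iii) $T(f,\pi)=0$ if $\pi$ is constant on a neighbourhood of $\operatorname{spt} f$. Let $\|T\|$ be the minimal measure in (i), $\operatorname{spt}T$ its support, $\mathbf M(T)=\|T\|(X)$, $\partial T(f)=T(1,f)$ and $\|\partial T\|_{\mathrm{KR}}=\sup\{\partial T(f):\mathrm{Lip}(f)\le 1\}$. For a Borel set $B$ let $(T\llcorner B)(f,\pi)=T(\mathbf 1_Bf,\pi)$, where $T(\cdot,\pi)$ is extended by continuity to $L^1(\|T\|)$. Let $\operatorname{spt}\|\partial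 T\|$ be the set of points $x$ such that every neighbourhood of $x$ contains the support of a bounded Lipschitz function $f$ with $\partial T(f)\ne 0$ (this makes sense even if $\partial T$ has infinite mass, and is the support of the measure $\|\partial T\|$ if the mass is finite). Then for every $\varepsilon>0$ there are a current $C\in\mathbf M_1(X)$ and a Borel set $B\subset X$ such that 1. $\partial C=0$; 2. $T=C\llcorner B$, and, with $R:=C\llcorner B^c$, the measures $\|T\|$ and $\|R\|$ are mutually singular; 3. $\operatorname{spt}R\subset\operatorname{conv}\{x\in X:\operatorname{dist}(x,\operatorname{spt}\|\partial T\|)\le\varepsilon\}$ (where $\operatorname{dist}(x,\emptyset)=+\infty$); 4. $\mathbf M(C)\le\mathbf M(T)+\|\partial T\|_{\mathrm{KR}}+\varepsilon$. The mass bound is sharp: if $C\in\mathbf M_1(X)$ satisfies $\partial C=0$ and $T=C\llcorner B$ for some Borel set $B$, then $\mathbf M(C)\ge\mathbf M(T)+\|\partial T\|_{\mathrm{KR}}$. -/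

import Mathlib

open MeasureTheory Filter Topology Set
open scoped ENNReal NNReal

/-- The vector space of real-valued Lipschitz functions on `X`. -/
def LipFun (X : Type*) [MetricSpace X] : Submodule ℝ (X → ℝ) where
  carrier := {f | ∃ K : ℝ≥0, LipschitzWith K f}
  add_mem' := by
    rintro f g ⟨K, hK⟩ ⟨L, hL⟩
    exact ⟨K + L, hK.add hL⟩
  zero_mem' := ⟨0, LipschitzWith.const 0⟩
  smul_mem' := by
    rintro c f ⟨K, hK⟩
    exact ⟨‖c‖₊ * K, (lipschitzWith_smul c).comp hK⟩

/-- The vector space of bounded real-valued Lipschitz functions on `X`. -/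
def BddLipFun (X : Type*) [MetricSpace X] : Submodule ℝ (X → ℝ) where
  carrier := {f | (∃ K : ℝ≥0, LipschitzWith K f) ∧ ∃ M : ℝ, ∀ x, |f x| ≤ M}
  add_mem' := by
    rintro f g ⟨⟨K, hK⟩, M, hM⟩ ⟨⟨L, hL⟩, N, hN⟩
    exact ⟨⟨K + L, hK.add hL⟩, M + N,
      fun x => (abs_add_le _ _).trans (add_le_add (hM x) (hN x))⟩
  zero_mem' := ⟨⟨0, LipschitzWith.const 0⟩, 0, fun x => by simp⟩
  smul_mem' := by
    rintro c f ⟨⟨K, hK⟩, M, hM⟩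
    refine ⟨⟨‖c‖₊ * K, (lipschitzWith_smul c).comp hK⟩, |c| * M, fun x => ?_⟩
    simp only [Pi.smul_apply, smul_eq_mul, abs_mul]
    exact mul_le_mul_of_nonneg_left (hM x) (abs_nonneg c)

/-- The constant function `1`, as a bounded Lipschitz function. -/
def BddLipFun.one (X : Type*) [MetricSpace X] : BddLipFun X :=
  ⟨fun _ => 1, ⟨0, LipschitzWith.const 1⟩, 1, fun _ => by simp⟩

/-- The product of two bounded Lipschitz functions. -/
def BddLipFun.mul {X : Type*} [MetricSpace X] (f g : BddLipFun X) : BddLipFun X :=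
  ⟨fun x => f.1 x * g.1 x, by
    obtain ⟨⟨K, hK⟩, M, hM⟩ := f.2
    obtain ⟨⟨L, hL⟩, N, hN⟩ := g.2
    refine ⟨⟨M.toNNReal * L + N.toNNReal * K, ?_⟩, M * N, fun x => ?_⟩
    · refine LipschitzWith.of_dist_le_mul fun x y => ?_
      have hM0 : 0 ≤ M := (abs_nonneg _).trans (hM x)
      have hN0 : 0 ≤ N := (abs_nonneg _).trans (hN x)
      have h1 := hK.dist_le_mul x y
      have h2 := hL.dist_le_mul x y
      rw [Real.dist_eq] at h1 h2 ⊢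
      push_cast
      rw [Real.coe_toNNReal _ hM0, Real.coe_toNNReal _ hN0]
      have h3 : f.1 x * g.1 x - f.1 y * g.1 y
          = f.1 x * (g.1 x - g.1 y) + (f.1 x - f.1 y) * g.1 y := by ring
      rw [h3]
      calc |f.1 x * (g.1 x - g.1 y) + (f.1 x - f.1 y) * g.1 y|
          ≤ |f.1 x| * |g.1 x - g.1 y| + |f.1 x - f.1 y| * |g.1 y| := by
            rw [← abs_mul, ← abs_mul]; exact abs_add_le _ _
        _ ≤ M * (L * dist x y) + (K * dist x y) * N := by
            gcongr
            · exact hM x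
            · exact hN y
        _ = (M * L + N * K) * dist x y := by ring
    · rw [abs_mul]
      exact mul_le_mul (hM x) (hN x) (abs_nonneg _) ((abs_nonneg _).trans (hM x))⟩

/-- The inequality `|T(f, π)| ≤ Lip(π) ∫ |f| dμ` for all metric `1`-forms `(f, π)`. -/
def ControlledBy {X : Type*} [MetricSpace X] [MeasurableSpace X]
    (T : BddLipFun X →ₗ[ℝ] LipFun X →ₗ[ℝ] ℝ) (μ : Measure X) : Prop :=
  ∀ (f : BddLipFun X) (π : LipFun X) (K : ℝ≥0), LipschitzWith K π.1 →
    |T f π| ≤ K * ∫ x, |f.1 x| ∂μ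

/-- One-dimensional metric currents: the space `M₁(X)`. -/
structure MetricCurrent (X : Type*) [MetricSpace X] [MeasurableSpace X] where
  /-- the underlying bilinear functional on metric `1`-forms `(f, π)` -/
  toFun : BddLipFun X →ₗ[ℝ] LipFun X →ₗ[ℝ] ℝ
  finite_mass : ∃ μ : Measure X, IsFiniteMeasure μ ∧ ControlledBy toFun μ
  continuity : ∀ (f : BddLipFun X) (π : ℕ → LipFun X) (π₀ : LipFun X) (K : ℝ≥0),
    (∀ j, LipschitzWith K (π j).1) →
    (∀ x, Tendsto (fun j => (π j).1 x) atTop (𝓝 (π₀.1 x))) →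
    Tendsto (fun j => toFun f (π j)) atTop (𝓝 (toFun f π₀))
  locality : ∀ (f : BddLipFun X) (π : LipFun X),
    (∃ U : Set X, IsOpen U ∧ tsupport f.1 ⊆ U ∧ ∃ c : ℝ, ∀ x ∈ U, π.1 x = c) →
    toFun f π = 0

namespace MetricCurrent

noncomputable section

variable {X : Type*} [MetricSpace X] [MeasurableSpace X]

/-- The mass measure `‖T‖`: the minimal finite Borel measure controlling `T`. -/
def massMeasure (T : MetricCurrent X) : Measure X :=
  sInf {μ : Measure X | IsFiniteMeasure μ ∧ ControlledBy T.toFun μ}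

/-- The mass `M(T) = ‖T‖(X)`. -/
def mass (T : MetricCurrent X) : ℝ≥0∞ := T.massMeasure univ

/-- The support of `T` is the support of its mass measure. -/
def spt (T : MetricCurrent X) : Set X := T.massMeasure.support

/-- The boundary `∂T(f) = T(1, f)`, on all Lipschitz functions `f`. (By the continuity axiom
it is determined by its values on bounded Lipschitz functions.) -/
def boundary (T : MetricCurrent X) : LipFun X →ₗ[ℝ] ℝ := T.toFun (BddLipFun.one X)

/-- A cycle is a current with zero boundary. -/
def IsCycle (T : MetricCurrent X) : Prop := T.boundary = 0

/-- The Kantorovich–Rubinstein norm `‖∂T‖_KR = sup {∂T(f) : Lip(f) ≤ 1}`. -/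
def boundaryKR (T : MetricCurrent X) : ℝ≥0∞ :=
  ⨆ (f : LipFun X) (_ : LipschitzWith 1 f.1), ENNReal.ofReal (T.boundary f)

/-- The support of `∂T`: the points `x` such that every neighbourhood of `x` contains the
support of some bounded Lipschitz function `f` with `∂T(f) ≠ 0`. It is the support of the
(possibly infinite) variation `‖∂T‖`, and does not need `∂T` to have finite mass. -/
def boundarySpt (T : MetricCurrent X) : Set X :=
  {x | ∀ U ∈ 𝓝 x, ∃ (f : LipFun X) (_ : f.1 ∈ BddLipFun X), tsupport f.1 ⊆ U ∧ T.boundary f ≠ 0}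

/-- Convergence of bounded Lipschitz functions to `g` in `L¹(μ)`. -/
def L1Nhds (μ : Measure X) (g : X → ℝ) : Filter (BddLipFun X) :=
  comap (fun f : BddLipFun X => ∫⁻ x, ‖f.1 x - g x‖ₑ ∂μ) (𝓝 0)

/-- Some finite measure controlling `T`. -/
def controlMeasure (T : MetricCurrent X) : Measure X := T.finite_mass.choose

instance (T : MetricCurrent X) : IsFiniteMeasure T.controlMeasure :=
  T.finite_mass.choose_spec.1

theorem controlledBy_controlMeasure (T : MetricCurrent X) :
    ControlledBy T.toFun T.controlMeasure :=
  T.finite_mass.choose_spec.2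

/-- The extension of `T(·, π)` by `L¹`-continuity to a function `g` that is an `L¹`-limit of
bounded Lipschitz functions: `T(g, π) = lim T(f, π)` as `f → g` in `L¹`. (The value does not
depend on the controlling measure: see `tendsto_restrict`.) -/
def extend (T : MetricCurrent X) (g : X → ℝ) (π : LipFun X) : ℝ :=
  limUnder (L1Nhds T.controlMeasure g) (fun f => T.toFun f π)

section Restrict

set_option linter.unusedSectionVars false

variable [BorelSpace X]

theorem measurable_bddLip (f : BddLipFun X) : Measurable f.1 := by
  obtain ⟨K, hK⟩ := f.2.1
  exact hK.continuous.measurable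

theorem integral_le_of_lintegral {μ : Measure X} {f : X → ℝ} (hf : Measurable f) :
    ENNReal.ofReal (∫ x, |f x| ∂μ) ≤ ∫⁻ x, ‖f x‖ₑ ∂μ := by
  rw [integral_eq_lintegral_of_nonneg_ae (Eventually.of_forall fun x => abs_nonneg _)
    hf.abs.aestronglyMeasurable]
  refine ENNReal.ofReal_toReal_le.trans (le_of_eq ?_)
  refine lintegral_congr fun x => ?_
  rw [← Real.norm_eq_abs, ofReal_norm]

/-- `|T(f, π)| ≤ Lip(π) ∫ |f| dμ`, in extended non-negative reals. -/
theorem enorm_le_of_controlledBy {T : BddLipFun X →ₗ[ℝ] LipFun X →ₗ[ℝ] ℝ} {μ : Measure X}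
    (h : ControlledBy T μ) (f : BddLipFun X) (π : LipFun X) {K : ℝ≥0}
    (hK : LipschitzWith K π.1) : ‖T f π‖ₑ ≤ K * ∫⁻ x, ‖f.1 x‖ₑ ∂μ := by
  rw [← ofReal_norm, Real.norm_eq_abs]
  refine (ENNReal.ofReal_le_ofReal (h f π K hK)).trans ?_
  rw [ENNReal.ofReal_mul K.coe_nonneg, ENNReal.ofReal_coe_nnreal]
  gcongr
  exact integral_le_of_lintegral (measurable_bddLip f)

/-- Lipschitz cutoff functions converging to the indicator of a Borel set in `L¹`. -/
theorem exists_cutoff (μ : Measure X) [IsFiniteMeasure μ] {B : Set X} (hB : MeasurableSet B) :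
    ∃ χ : ℕ → BddLipFun X, (∀ n x, |(χ n).1 x| ≤ 1) ∧
      Tendsto (fun n => ∫⁻ x, ‖(χ n).1 x - B.indicator 1 x‖ₑ ∂μ) atTop (𝓝 0) := by
  have key : ∀ ε : ℝ≥0∞, 0 < ε → ∃ χ : BddLipFun X, (∀ x, |χ.1 x| ≤ 1) ∧
      ∫⁻ x, ‖χ.1 x - B.indicator 1 x‖ₑ ∂μ ≤ ε := by
    intro ε hε
    have hε2 : ε / 2 ≠ 0 := (ENNReal.half_pos hε.ne').ne'
    obtain ⟨F, hFB, hFc, hF⟩ := hB.exists_isClosed_sdiff_lt (measure_ne_top μ B) hε2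
    obtain ⟨u, -, hu0, hu⟩ := exists_seq_strictAnti_tendsto (0 : ℝ)
    let θ : ℕ → X → ℝ := fun n x => (thickenedIndicator (hu0 n) F x : ℝ)
    have hθ1 : ∀ n x, |θ n x| ≤ 1 := fun n x => by
      rw [abs_of_nonneg (NNReal.coe_nonneg _)]
      exact_mod_cast thickenedIndicator_le_one (hu0 n) F x
    have hθL : ∀ n, LipschitzWith (u n).toNNReal⁻¹ (θ n) := fun n => by
      have h := lipschitzWith_thickenedIndicator (hu0 n) F
      intro x y
      exact h x y
    have hlim : Tendsto (fun n => ∫⁻ x, ‖θ n x - F.indicator 1 x‖ₑ ∂μ) atTop (𝓝 0) := by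
      have h0 : ∫⁻ _ : X, (0 : ℝ≥0∞) ∂μ = 0 := lintegral_zero
      rw [← h0]
      refine tendsto_lintegral_of_dominated_convergence (fun _ => 2) ?_ ?_ ?_ ?_
      · intro n
        exact (((hθL n).continuous.measurable).sub
          (measurable_one.indicator hFc.measurableSet)).enorm
      · intro n
        refine Eventually.of_forall fun x => ?_
        have hb : ‖θ n x - F.indicator 1 x‖ ≤ 2 := by
          refine (norm_sub_le _ _).trans ?_
          have h1 : ‖θ n x‖ ≤ 1 := hθ1 n x
          have h2 : ‖F.indicator (1 : X → ℝ) x‖ ≤ 1 := by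
            by_cases hx : x ∈ F <;> simp [hx]
          linarith
        change ‖θ n x - F.indicator 1 x‖ₑ ≤ 2
        rw [← ofReal_norm]
        exact (ENNReal.ofReal_le_ofReal hb).trans (by simp)
      · simp [ENNReal.mul_eq_top]
      · refine Eventually.of_forall fun x => ?_
        have hx := tendsto_pi_nhds.1
          (thickenedIndicator_tendsto_indicator_closure hu0 hu F) x
        rw [hFc.closure_eq] at hx
        have hx' : Tendsto (fun n => θ n x) atTop (𝓝 (F.indicator (1 : X → ℝ) x)) := by
          have := (NNReal.tendsto_coe.2 hx)
          convert this using 2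
          by_cases hxF : x ∈ F <;> simp [hxF]
        have := (hx'.sub_const (F.indicator (1 : X → ℝ) x)).enorm
        simpa using this
    obtain ⟨n, hn⟩ := ((tendsto_order.1 hlim).2 (ε / 2) (pos_iff_ne_zero.2 hε2)).exists
    refine ⟨⟨θ n, ⟨_, hθL n⟩, 1, hθ1 n⟩, hθ1 n, ?_⟩
    have hdiff : ∫⁻ x, ‖F.indicator (1 : X → ℝ) x - B.indicator 1 x‖ₑ ∂μ ≤ ε / 2 := by
      have : ∀ x, ‖F.indicator (1 : X → ℝ) x - B.indicator 1 x‖ₑ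
          = (B \ F).indicator (1 : X → ℝ≥0∞) x := by
        intro x
        by_cases hxF : x ∈ F
        · simp [hxF, hFB hxF]
        · by_cases hxB : x ∈ B <;> simp [hxF, hxB]
      simp_rw [this]
      rw [lintegral_indicator_one (hB.diff hFc.measurableSet)]
      exact hF.le
    calc ∫⁻ x, ‖θ n x - B.indicator 1 x‖ₑ ∂μ
        ≤ ∫⁻ x, (‖θ n x - F.indicator 1 x‖ₑ
            + ‖F.indicator (1 : X → ℝ) x - B.indicator 1 x‖ₑ) ∂μ := by
          refine lintegral_mono fun x => ?_
          rw [← sub_add_sub_cancel (θ n x) (F.indicator 1 x) (B.indicator 1 x)]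
          exact enorm_add_le _ _
      _ = ∫⁻ x, ‖θ n x - F.indicator 1 x‖ₑ ∂μ
            + ∫⁻ x, ‖F.indicator (1 : X → ℝ) x - B.indicator 1 x‖ₑ ∂μ :=
          lintegral_add_left (((hθL n).continuous.measurable).sub
            (measurable_one.indicator hFc.measurableSet)).enorm _
      _ ≤ ε / 2 + ε / 2 := add_le_add hn.le hdiff
      _ = ε := ENNReal.add_halves ε
  choose χ h1 h2 using fun n : ℕ =>
    key ((n : ℝ≥0∞) + 1)⁻¹ (ENNReal.inv_pos.2 (by finiteness))
  refine ⟨χ, h1, ?_⟩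
  have hlim : Tendsto (fun n : ℕ => ((n : ℝ≥0∞) + 1)⁻¹) atTop (𝓝 0) := by
    have := (tendsto_add_atTop_iff_nat 1).2 ENNReal.tendsto_inv_nat_nhds_zero
    simpa using this
  exact tendsto_of_tendsto_of_tendsto_of_le_of_le tendsto_const_nhds hlim
    (fun _ => zero_le) h2

theorem cutoff_mul_tendsto {μ : Measure X} {B : Set X} {χ : ℕ → BddLipFun X}
    (hχ : Tendsto (fun n => ∫⁻ x, ‖(χ n).1 x - B.indicator 1 x‖ₑ ∂μ) atTop (𝓝 0))
    (f : BddLipFun X) :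
    Tendsto (fun n => BddLipFun.mul (χ n) f) atTop (L1Nhds μ (B.indicator f.1)) := by
  obtain ⟨M, hM⟩ := f.2.2
  rw [L1Nhds, tendsto_comap_iff]
  have h := ENNReal.Tendsto.mul_const (b := ENNReal.ofReal M) hχ (Or.inr ENNReal.ofReal_ne_top)
  rw [zero_mul] at h
  refine tendsto_of_tendsto_of_tendsto_of_le_of_le tendsto_const_nhds h (fun _ => zero_le) ?_
  intro n
  simp only [Function.comp_apply]
  rw [← lintegral_mul_const' _ _ ENNReal.ofReal_ne_top]
  refine lintegral_mono fun x => ?_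
  have e : (BddLipFun.mul (χ n) f).1 x - B.indicator f.1 x
      = ((χ n).1 x - B.indicator 1 x) * f.1 x := by
    by_cases hx : x ∈ B <;> simp [BddLipFun.mul, hx, sub_mul]
  rw [e, enorm_mul]
  gcongr
  rw [← ofReal_norm]
  exact ENNReal.ofReal_le_ofReal (hM x)

/-- The difference of two values of `T` is controlled by the distance in `L¹` to `g`. -/
theorem edist_le_of_controlledBy {T : BddLipFun X →ₗ[ℝ] LipFun X →ₗ[ℝ] ℝ} {μ : Measure X}
    (h : ControlledBy T μ) (f f' : BddLipFun X) {g : X → ℝ} (hg : Measurable g)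
    (π : LipFun X) {K : ℝ≥0} (hK : LipschitzWith K π.1) :
    edist (T f π) (T f' π)
      ≤ K * (∫⁻ x, ‖f.1 x - g x‖ₑ ∂μ + ∫⁻ x, ‖f'.1 x - g x‖ₑ ∂μ) := by
  have e : T f π - T f' π = T (f - f') π := by simp
  rw [edist_eq_enorm_sub, e]
  refine (enorm_le_of_controlledBy h (f - f') π hK).trans ?_
  gcongr
  have hm : Measurable fun x => ‖f.1 x - g x‖ₑ := ((measurable_bddLip f).sub hg).enorm
  rw [← lintegral_add_left hm]
  refine lintegral_mono fun x => ?_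
  have e2 : (f - f').1 x = (f.1 x - g x) - (f'.1 x - g x) := by
    simp
  rw [e2]
  exact enorm_sub_le

/-- `T(f, π)` converges to `T(1_B f₀, π)` as `f → 1_B f₀` in `L¹`. -/
theorem tendsto_extend (T : MetricCurrent X) {B : Set X} (hB : MeasurableSet B)
    (f₀ : BddLipFun X) (π : LipFun X) :
    Tendsto (fun f => T.toFun f π) (L1Nhds T.controlMeasure (B.indicator f₀.1))
      (𝓝 (T.extend (B.indicator f₀.1) π)) := by
  obtain ⟨χ, -, hχ⟩ := exists_cutoff T.controlMeasure hB
  have hne : (L1Nhds T.controlMeasure (B.indicator f₀.1)).NeBot :=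
    (cutoff_mul_tendsto hχ f₀).neBot
  obtain ⟨K, hK⟩ := π.2
  have hg : Measurable (B.indicator f₀.1) := (measurable_bddLip f₀).indicator hB
  have hc : Cauchy (map (fun f => T.toFun f π)
      (L1Nhds T.controlMeasure (B.indicator f₀.1))) := by
    refine ⟨hne.map _, ?_⟩
    rw [prod_map_map_eq]
    refine (uniformity_basis_edist.tendsto_right_iff (f := fun p :
      BddLipFun X × BddLipFun X => (T.toFun p.1 π, T.toFun p.2 π))).2 fun ε hε => ?_
    have t : Tendsto (fun f : BddLipFun X =>
        ∫⁻ x, ‖f.1 x - B.indicator f₀.1 x‖ₑ ∂T.controlMeasure)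
        (L1Nhds T.controlMeasure (B.indicator f₀.1)) (𝓝 0) := tendsto_comap
    have t2 := ENNReal.Tendsto.const_mul (a := (K : ℝ≥0∞))
      ((t.comp tendsto_fst).add (t.comp (tendsto_snd
        (f := L1Nhds T.controlMeasure (B.indicator f₀.1))))) (Or.inr ENNReal.coe_ne_top)
    rw [add_zero, mul_zero] at t2
    filter_upwards [(tendsto_order.1 t2).2 ε hε] with p hp
    exact (edist_le_of_controlledBy T.controlledBy_controlMeasure p.1 p.2 hg π hK).trans_lt hp
  exact hc.le_nhds_lim

theorem edist_extend_le (T : MetricCurrent X) {B : Set X} (hB : MeasurableSet B)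
    {μ : Measure X} (hμ : ControlledBy T.toFun μ) (f f₀ : BddLipFun X) (π : LipFun X)
    {K : ℝ≥0} (hK : LipschitzWith K π.1) {χ : ℕ → BddLipFun X}
    (h : Tendsto (fun n => T.toFun (BddLipFun.mul (χ n) f₀) π) atTop
      (𝓝 (T.extend (B.indicator f₀.1) π)))
    (hχ : Tendsto (fun n => ∫⁻ x, ‖(χ n).1 x - B.indicator 1 x‖ₑ ∂μ) atTop (𝓝 0)) :
    edist (T.toFun f π) (T.extend (B.indicator f₀.1) π)
      ≤ K * ∫⁻ x, ‖f.1 x - B.indicator f₀.1 x‖ₑ ∂μ := by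
  have hg : Measurable (B.indicator f₀.1) := (measurable_bddLip f₀).indicator hB
  have hc : Tendsto (fun m => ∫⁻ x, ‖(BddLipFun.mul (χ m) f₀).1 x - B.indicator f₀.1 x‖ₑ ∂μ)
      atTop (𝓝 0) :=
    (tendsto_comap (f := fun f : BddLipFun X => ∫⁻ x, ‖f.1 x - B.indicator f₀.1 x‖ₑ ∂μ)).comp
      (cutoff_mul_tendsto hχ f₀)
  have hr : Tendsto (fun m => (K : ℝ≥0∞) * (∫⁻ x, ‖f.1 x - B.indicator f₀.1 x‖ₑ ∂μ
        + ∫⁻ x, ‖(BddLipFun.mul (χ m) f₀).1 x - B.indicator f₀.1 x‖ₑ ∂μ)) atTop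
      (𝓝 ((K : ℝ≥0∞) * (∫⁻ x, ‖f.1 x - B.indicator f₀.1 x‖ₑ ∂μ + 0))) :=
    ENNReal.Tendsto.const_mul
      (tendsto_const_nhds.add hc)
      (Or.inr ENNReal.coe_ne_top)
  rw [add_zero] at hr
  exact le_of_tendsto_of_tendsto' (tendsto_const_nhds.edist h) hr
    (fun m => edist_le_of_controlledBy hμ _ _ hg π hK)

/-- The restriction `T ⌞ B`, given by `(T ⌞ B)(f, π) = T(1_B f, π)`. -/
def restrict (T : MetricCurrent X) {B : Set X} (hB : MeasurableSet B) : MetricCurrent X :=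
  have hlim : ∃ χ : ℕ → BddLipFun X, (∀ n x, |(χ n).1 x| ≤ 1) ∧
      Tendsto (fun n => ∫⁻ x, ‖(χ n).1 x - B.indicator 1 x‖ₑ ∂T.controlMeasure) atTop (𝓝 0) ∧
      ∀ f π, Tendsto (fun n => T.toFun (BddLipFun.mul (χ n) f) π) atTop
        (𝓝 (T.extend (B.indicator f.1) π)) := by
    obtain ⟨χ, h1, hχ⟩ := exists_cutoff T.controlMeasure hB
    exact ⟨χ, h1, hχ, fun f π => (T.tendsto_extend hB f π).comp (cutoff_mul_tendsto hχ f)⟩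
  { toFun := LinearMap.mk₂ ℝ (fun f π => T.extend (B.indicator f.1) π)
      (by
        obtain ⟨χ, -, -, h⟩ := hlim
        intro f f' π
        refine tendsto_nhds_unique (h (f + f') π) (((h f π).add (h f' π)).congr fun n => ?_)
        have e : BddLipFun.mul (χ n) (f + f')
            = BddLipFun.mul (χ n) f + BddLipFun.mul (χ n) f' := by
          ext x; simp [BddLipFun.mul, mul_add]
        rw [e]; simp)
      (by
        obtain ⟨χ, -, -, h⟩ := hlim
        intro c f π
        refine tendsto_nhds_unique (h (c • f) π) (((h f π).const_smul c).congr fun n => ?_)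
        have e : BddLipFun.mul (χ n) (c • f) = c • BddLipFun.mul (χ n) f := by
          ext x; simp [BddLipFun.mul]; ring
        rw [e]; simp)
      (by
        obtain ⟨χ, -, -, h⟩ := hlim
        intro f π π'
        exact tendsto_nhds_unique (h f (π + π'))
          (((h f π).add (h f π')).congr fun n => by simp))
      (by
        obtain ⟨χ, -, -, h⟩ := hlim
        intro c f π
        exact tendsto_nhds_unique (h f (c • π))
          (((h f π).const_smul c).congr fun n => by simp))
    finite_mass := by
      obtain ⟨χ, h1, -, h⟩ := hlim
      refine ⟨T.controlMeasure, inferInstance, fun f π K hK => ?_⟩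
      refine le_of_tendsto (h f π).abs (Eventually.of_forall fun n => ?_)
      refine (T.controlledBy_controlMeasure _ π K hK).trans ?_
      gcongr ?_ * ?_
      obtain ⟨M, hM⟩ := f.2.2
      refine integral_mono_of_nonneg (Eventually.of_forall fun x => abs_nonneg _) ?_
        (Eventually.of_forall fun x => ?_)
      · exact Integrable.of_bound (measurable_bddLip f).abs.aestronglyMeasurable M
          (Eventually.of_forall fun x => by simpa using hM x)
      · change |(χ n).1 x * f.1 x| ≤ |f.1 x|
        rw [abs_mul]
        exact mul_le_of_le_one_left (abs_nonneg _) (h1 n x)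
    continuity := by
      obtain ⟨χ, -, hχ, h⟩ := hlim
      intro f π π₀ K hK hπ
      have hK₀ : LipschitzWith K π₀.1 := by
        refine LipschitzWith.of_dist_le_mul fun x y => ?_
        exact le_of_tendsto ((hπ x).dist (hπ y))
          (Eventually.of_forall fun j => (hK j).dist_le_mul x y)
      have ht : Tendsto (fun n => (K : ℝ≥0∞) *
          ∫⁻ x, ‖(BddLipFun.mul (χ n) f).1 x - B.indicator f.1 x‖ₑ ∂T.controlMeasure)
          atTop (𝓝 0) := by
        have := ENNReal.Tendsto.const_mul (a := (K : ℝ≥0∞))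
          (tendsto_comap.comp (cutoff_mul_tendsto hχ f)) (Or.inr ENNReal.coe_ne_top)
        rw [mul_zero] at this
        exact this
      rw [EMetric.tendsto_nhds]
      intro ε hε
      have hε3 : 0 < ε / 3 := ENNReal.div_pos hε.ne' (by finiteness)
      obtain ⟨n, hn⟩ := ((tendsto_order.1 ht).2 (ε / 3) hε3).exists
      filter_upwards [EMetric.tendsto_nhds.1
        (T.continuity (BddLipFun.mul (χ n) f) π π₀ K hK hπ) (ε / 3) hε3] with j hj
      have a := (T.edist_extend_le hB T.controlledBy_controlMeasure
        (BddLipFun.mul (χ n) f) f (π j) (hK j) (h f (π j)) hχ).trans_lt hn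
      have b := (T.edist_extend_le hB T.controlledBy_controlMeasure
        (BddLipFun.mul (χ n) f) f π₀ hK₀ (h f π₀) hχ).trans_lt hn
      calc edist (T.extend (B.indicator f.1) (π j)) (T.extend (B.indicator f.1) π₀)
          ≤ edist (T.extend (B.indicator f.1) (π j)) (T.toFun (BddLipFun.mul (χ n) f) (π j))
            + edist (T.toFun (BddLipFun.mul (χ n) f) (π j)) (T.toFun (BddLipFun.mul (χ n) f) π₀)
            + edist (T.toFun (BddLipFun.mul (χ n) f) π₀) (T.extend (B.indicator f.1) π₀) :=
              edist_triangle4 _ _ _ _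
        _ < ε / 3 + ε / 3 + ε / 3 :=
              ENNReal.add_lt_add (ENNReal.add_lt_add (by rw [edist_comm]; exact a) hj) b
        _ = ε := ENNReal.add_thirds ε
    locality := by
      obtain ⟨χ, -, -, h⟩ := hlim
      rintro f π ⟨U, hU, hfU, c, hc⟩
      refine tendsto_nhds_unique (h f π) (tendsto_const_nhds.congr fun n => ?_)
      refine (T.locality _ π ⟨U, hU, subset_trans ?_ hfU, c, hc⟩).symm
      exact tsupport_mul_subset_right }

theorem restrict_apply (T : MetricCurrent X) {B : Set X} (hB : MeasurableSet B)
    (f : BddLipFun X) (π : LipFun X) :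
    (T.restrict hB).toFun f π = T.extend (B.indicator f.1) π := rfl

/-- The restriction does not depend on the measure used to define it: if `μ` is any finite
measure controlling `T`, then `T(f, π) → (T ⌞ B)(f₀, π)` as `f → 1_B f₀` in `L¹(μ)`. -/
theorem tendsto_restrict (T : MetricCurrent X) {B : Set X} (hB : MeasurableSet B)
    (μ : Measure X) [IsFiniteMeasure μ] (hμ : ControlledBy T.toFun μ)
    (f₀ : BddLipFun X) (π : LipFun X) :
    Tendsto (fun f => T.toFun f π) (L1Nhds μ (B.indicator f₀.1))
      (𝓝 ((T.restrict hB).toFun f₀ π)) := by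
  rw [restrict_apply]
  obtain ⟨χ, -, hχ⟩ := exists_cutoff (μ + T.controlMeasure) hB
  have h1 : Tendsto (fun n => ∫⁻ x, ‖(χ n).1 x - B.indicator 1 x‖ₑ ∂μ) atTop (𝓝 0) :=
    tendsto_of_tendsto_of_tendsto_of_le_of_le tendsto_const_nhds hχ (fun _ => zero_le)
      (fun n => lintegral_mono' (Measure.le_add_right le_rfl) le_rfl)
  have h2 : Tendsto (fun n => ∫⁻ x, ‖(χ n).1 x - B.indicator 1 x‖ₑ ∂T.controlMeasure)
      atTop (𝓝 0) :=
    tendsto_of_tendsto_of_tendsto_of_le_of_le tendsto_const_nhds hχ (fun _ => zero_le)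
      (fun n => lintegral_mono' (Measure.le_add_left le_rfl) le_rfl)
  have h3 := (T.tendsto_extend hB f₀ π).comp (cutoff_mul_tendsto h2 f₀)
  obtain ⟨K, hK⟩ := π.2
  have hle : ∀ f : BddLipFun X, edist (T.toFun f π) (T.extend (B.indicator f₀.1) π)
      ≤ K * ∫⁻ x, ‖f.1 x - B.indicator f₀.1 x‖ₑ ∂μ :=
    fun f => T.edist_extend_le hB hμ f f₀ π hK h3 h1
  rw [tendsto_iff_edist_tendsto_0]
  have ht := ENNReal.Tendsto.const_mul (a := (K : ℝ≥0∞))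
    (tendsto_comap (f := fun f : BddLipFun X => ∫⁻ x, ‖f.1 x - B.indicator f₀.1 x‖ₑ ∂μ)
      (x := 𝓝 0)) (Or.inr ENNReal.coe_ne_top)
  rw [mul_zero] at ht
  exact tendsto_of_tendsto_of_tendsto_of_le_of_le tendsto_const_nhds ht (fun _ => zero_le) hle

end Restrict

end

end MetricCurrent

/-! It suffices to find a current `R` with `∂R = -∂T` and mass at most `‖∂T‖_KR + ε`, carried by a
`‖T‖`-null set `N` and by the prescribed convex hull. Then `C = T + R` is a cycle, and restricting
it to `Nᶜ` and to `N` gives back `T` and `R` (`restrict_eq_of_add`).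

The boundary is a functional on Lipschitz functions that is continuous under pointwise convergence
with bounded Lipschitz constants, and this makes it a convergent sum of dipoles. On finitely many
points, Hahn-Banach gives a combination of differences of evaluations whose transport cost is at
most the dual norm. Compactness makes the error small, and iterating on the error gives `∂T(f) = ∑
aᵢ (f(pᵢ) - f(qᵢ))` with `∑ |aᵢ| dist(pᵢ, qᵢ) ≤ ‖∂T‖_KR + ε` (`IsFlat.exists_hasSum`).

To have all `pᵢ, qᵢ` in the support of `∂T`, one must know that `∂T(f)` depends only on `f` on that
support, although `∂T` may have infinite mass and the support need not be compact. This is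
`apply_eq_zero_of_eqOn_zero`, proved by Zorn's lemma and Ekeland's principle.

Each dipole is filled by a broken line through a point near the midpoint. In dimension at least two
there is a one-parameter family of such lines whose open edges from a common endpoint are pairwise
disjoint, so all but countably many are `‖T‖`-null (`exists_detour`). The weighted sum of the broken
lines is `R` (`exists_filling`).

For sharpness, `‖C‖(B)` is at least `M(T)`. As `C` is a cycle, `∂T` is minus the boundary of the
restriction of `C` to `Bᶜ`, so `‖C‖(Bᶜ)` is at least `‖∂T‖_KR`. These estimates use that the infimum
defining the mass measure is itself a controlling measure (`controlledBy_massMeasure`). -/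

namespace MetricCurrent

/-! ### Restrictions, the mass measure and the lower mass bound. -/

section Control

variable {X : Type*} [MetricSpace X] [MeasurableSpace X]

/-- Two currents agreeing on all metric forms are equal. -/
theorem ext_toFun {S T : MetricCurrent X} (h : ∀ f π, S.toFun f π = T.toFun f π) : S = T := by
  cases S; cases T
  simp only [mk.injEq]
  exact LinearMap.ext fun f => LinearMap.ext fun π => h f π

theorem massMeasure_le (T : MetricCurrent X) {μ : Measure X} [IsFiniteMeasure μ]
    (h : ControlledBy T.toFun μ) : T.massMeasure ≤ μ :=
  sInf_le ⟨inferInstance, h⟩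

instance (T : MetricCurrent X) : IsFiniteMeasure T.massMeasure :=
  isFiniteMeasure_of_le _ (T.massMeasure_le T.controlledBy_controlMeasure)

theorem tendsto_lintegral_L1Nhds (μ : Measure X) (g : X → ℝ) :
    Tendsto (fun f : BddLipFun X => ∫⁻ x, ‖f.1 x - g x‖ₑ ∂μ) (L1Nhds μ g) (𝓝 0) :=
  tendsto_comap

theorem lintegral_bddLip_ne_top (μ : Measure X) [IsFiniteMeasure μ] (f : BddLipFun X) :
    ∫⁻ x, ‖f.1 x‖ₑ ∂μ ≠ ⊤ := by
  obtain ⟨M, hM⟩ := f.2.2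
  refine ne_top_of_le_ne_top (b := ∫⁻ _, ENNReal.ofReal M ∂μ) ?_ (lintegral_mono fun x => ?_)
  · rw [lintegral_const]
    finiteness
  · rw [← ofReal_norm]
    exact ENNReal.ofReal_le_ofReal (hM x)

theorem lintegral_indicator_enorm {X : Type*} [MeasurableSpace X] (μ : Measure X) {B : Set X}
    (hB : MeasurableSet B) (f : X → ℝ) :
    ∫⁻ x, ‖B.indicator f x‖ₑ ∂μ = ∫⁻ x in B, ‖f x‖ₑ ∂μ := by
  rw [← lintegral_indicator hB]
  exact lintegral_congr fun x => by by_cases hx : x ∈ B <;> simp [hx]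

variable [BorelSpace X]

theorem ofReal_integral_bddLip (μ : Measure X) [IsFiniteMeasure μ] (f : BddLipFun X) :
    ENNReal.ofReal (∫ x, |f.1 x| ∂μ) = ∫⁻ x, ‖f.1 x‖ₑ ∂μ := by
  rw [integral_eq_lintegral_of_nonneg_ae (Eventually.of_forall fun x => abs_nonneg _)
    (measurable_bddLip f).abs.aestronglyMeasurable]
  have e : ∀ x, ENNReal.ofReal |f.1 x| = ‖f.1 x‖ₑ := fun x => by
    rw [← Real.norm_eq_abs, ofReal_norm]
  simp_rw [e]
  exact ENNReal.ofReal_toReal (lintegral_bddLip_ne_top μ f)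

/-- The control inequality in extended non-negative reals. -/
theorem controlledBy_of_enorm_le {T : BddLipFun X →ₗ[ℝ] LipFun X →ₗ[ℝ] ℝ} {μ : Measure X}
    [IsFiniteMeasure μ] (h : ∀ (f : BddLipFun X) (π : LipFun X) (K : ℝ≥0), LipschitzWith K π.1 →
      ‖T f π‖ₑ ≤ K * ∫⁻ x, ‖f.1 x‖ₑ ∂μ) : ControlledBy T μ := by
  intro f π K hK
  have h1 := h f π K hK
  rw [← ofReal_norm, Real.norm_eq_abs, ← ofReal_integral_bddLip, ← ENNReal.ofReal_coe_nnreal,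
    ← ENNReal.ofReal_mul K.coe_nonneg] at h1
  exact (ENNReal.ofReal_le_ofReal_iff
    (mul_nonneg K.coe_nonneg (integral_nonneg fun _ => abs_nonneg _))).1 h1

/-- The control inequality passes to the limit along cutoffs of `B`. Any finite controlling measure
is allowed, not only the one used to define `restrict`, so that `T.massMeasure` can be inserted
later. -/
theorem enorm_restrict_le (T : MetricCurrent X) {B : Set X} (hB : MeasurableSet B)
    {μ : Measure X} [IsFiniteMeasure μ] (hμ : ControlledBy T.toFun μ) (f : BddLipFun X)
    (π : LipFun X) {K : ℝ≥0} (hK : LipschitzWith K π.1) :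
    ‖(T.restrict hB).toFun f π‖ₑ ≤ K * ∫⁻ x in B, ‖f.1 x‖ₑ ∂μ := by
  obtain ⟨χ, -, hχ⟩ := exists_cutoff μ hB
  have hc := cutoff_mul_tendsto hχ f
  have h1 := ((T.tendsto_restrict hB μ hμ f π).comp hc).enorm
  have h2 : Tendsto (fun n => ∫⁻ x, ‖(BddLipFun.mul (χ n) f).1 x - B.indicator f.1 x‖ₑ ∂μ)
      atTop (𝓝 0) := (tendsto_lintegral_L1Nhds _ _).comp hc
  have h3 : Tendsto (fun n => (K : ℝ≥0∞) *
      (∫⁻ x, ‖(BddLipFun.mul (χ n) f).1 x - B.indicator f.1 x‖ₑ ∂μ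
        + ∫⁻ x in B, ‖f.1 x‖ₑ ∂μ)) atTop (𝓝 (K * (0 + ∫⁻ x in B, ‖f.1 x‖ₑ ∂μ))) :=
    ENNReal.Tendsto.const_mul (h2.add tendsto_const_nhds) (Or.inr ENNReal.coe_ne_top)
  rw [zero_add] at h3
  refine le_of_tendsto_of_tendsto' h1 h3 fun n => ?_
  refine (enorm_le_of_controlledBy hμ _ π hK).trans ?_
  gcongr
  have hg : Measurable (B.indicator f.1) := (measurable_bddLip f).indicator hB
  rw [← lintegral_indicator_enorm μ hB, ← lintegral_add_right _ hg.enorm]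
  refine lintegral_mono fun x => ?_
  calc ‖(BddLipFun.mul (χ n) f).1 x‖ₑ
      = ‖((BddLipFun.mul (χ n) f).1 x - B.indicator f.1 x) + B.indicator f.1 x‖ₑ := by
        rw [sub_add_cancel]
    _ ≤ _ := enorm_add_le _ _

theorem controlledBy_restrict (T : MetricCurrent X) {B : Set X} (hB : MeasurableSet B)
    {μ : Measure X} [IsFiniteMeasure μ] (hμ : ControlledBy T.toFun μ) :
    ControlledBy (T.restrict hB).toFun (μ.restrict B) :=
  controlledBy_of_enorm_le fun f π _ hK => T.enorm_restrict_le hB hμ f π hK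

/-- If `T` is the sum of two functionals controlled by measures carried by `B` and by `Bᶜ`
respectively, then its restriction to `B` is the first one. -/
theorem restrict_eq_of_add (T : MetricCurrent X) {B : Set X} (hB : MeasurableSet B)
    {T₁ T₂ : BddLipFun X →ₗ[ℝ] LipFun X →ₗ[ℝ] ℝ} {μ₁ μ₂ : Measure X} [IsFiniteMeasure μ₁]
    [IsFiniteMeasure μ₂] (h₁ : ControlledBy T₁ μ₁) (h₂ : ControlledBy T₂ μ₂)
    (hT : T.toFun = T₁ + T₂) (hμ₁ : μ₁ Bᶜ = 0) (hμ₂ : μ₂ B = 0) :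
    (T.restrict hB).toFun = T₁ := by
  have hc : ControlledBy T.toFun (μ₁ + μ₂) := controlledBy_of_enorm_le fun f π K hK => by
    rw [hT, LinearMap.add_apply, LinearMap.add_apply, lintegral_add_measure, mul_add]
    exact (enorm_add_le _ _).trans (add_le_add (enorm_le_of_controlledBy h₁ f π hK)
      (enorm_le_of_controlledBy h₂ f π hK))
  obtain ⟨χ, -, hχ⟩ := exists_cutoff (μ₁ + μ₂) hB
  refine LinearMap.ext fun f => LinearMap.ext fun π => ?_
  obtain ⟨K, hK⟩ := π.2
  have hlim := (T.tendsto_restrict hB _ hc f π).comp (cutoff_mul_tendsto hχ f)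
  refine tendsto_nhds_unique hlim ?_
  rw [tendsto_iff_edist_tendsto_0]
  have h2 : Tendsto (fun n => (K : ℝ≥0∞) *
      ∫⁻ x, ‖(BddLipFun.mul (χ n) f).1 x - B.indicator f.1 x‖ₑ ∂(μ₁ + μ₂))
      atTop (𝓝 (K * 0)) :=
    ENNReal.Tendsto.const_mul ((tendsto_lintegral_L1Nhds _ _).comp (cutoff_mul_tendsto hχ f))
      (Or.inr ENNReal.coe_ne_top)
  rw [mul_zero] at h2
  refine tendsto_of_tendsto_of_tendsto_of_le_of_le tendsto_const_nhds h2 (fun _ => zero_le) ?_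
  intro n
  set g := BddLipFun.mul (χ n) f
  -- Here `g` is close to `1_B f` in `L¹`. The first term is small because `1_B f = f` almost
  -- everywhere for `μ₁`, the second because `1_B f = 0` almost everywhere for `μ₂`.
  have e : T.toFun g π - T₁ f π = T₁ (g - f) π + T₂ g π := by
    rw [hT]; simp; ring
  simp only [Function.comp_apply]
  rw [edist_eq_enorm_sub, e, lintegral_add_measure, mul_add]
  refine (enorm_add_le _ _).trans (add_le_add ?_ ?_)
  · refine (enorm_le_of_controlledBy h₁ _ π hK).trans (le_of_eq ?_)
    congr 1
    refine lintegral_congr_ae ?_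
    have : ∀ᵐ x ∂μ₁, x ∈ B := by rw [ae_iff]; exact hμ₁
    filter_upwards [this] with x hx
    simp [g, hx]
  · refine (enorm_le_of_controlledBy h₂ _ π hK).trans (le_of_eq ?_)
    congr 1
    refine lintegral_congr_ae ?_
    have : ∀ᵐ x ∂μ₂, x ∉ B := by rw [ae_iff]; simpa using hμ₂
    filter_upwards [this] with x hx
    simp [g, hx]

theorem restrict_union_apply (T : MetricCurrent X) {A B : Set X} (hA : MeasurableSet A)
    (hB : MeasurableSet B) (hAB : Disjoint A B) (f : BddLipFun X) (π : LipFun X) :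
    (T.restrict (hA.union hB)).toFun f π
      = (T.restrict hA).toFun f π + (T.restrict hB).toFun f π := by
  set μ := T.controlMeasure
  have hμ := T.controlledBy_controlMeasure
  obtain ⟨χ, -, hχ⟩ := exists_cutoff μ hA
  obtain ⟨ψ, -, hψ⟩ := exists_cutoff μ hB
  have h1 := (T.tendsto_restrict hA μ hμ f π).comp (cutoff_mul_tendsto hχ f)
  have h2 := (T.tendsto_restrict hB μ hμ f π).comp (cutoff_mul_tendsto hψ f)
  have h : Tendsto (fun n => ∫⁻ x, ‖(χ n + ψ n).1 x - (A ∪ B).indicator 1 x‖ₑ ∂μ)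
      atTop (𝓝 0) := by
    have := hχ.add hψ
    rw [add_zero] at this
    refine tendsto_of_tendsto_of_tendsto_of_le_of_le tendsto_const_nhds this
      (fun _ => zero_le) fun n => ?_
    have hm : Measurable fun x => ‖(χ n).1 x - A.indicator 1 x‖ₑ :=
      ((measurable_bddLip _).sub (measurable_one.indicator hA)).enorm
    simp only
    rw [← lintegral_add_left hm]
    refine lintegral_mono fun x => ?_
    have e : (χ n + ψ n).1 x - (A ∪ B).indicator 1 x
        = ((χ n).1 x - A.indicator 1 x) + ((ψ n).1 x - B.indicator 1 x) := by
      rw [indicator_union_of_disjoint hAB]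
      simp
      ring
    rw [e]
    exact enorm_add_le _ _
  have h3 := (T.tendsto_restrict (hA.union hB) μ hμ f π).comp (cutoff_mul_tendsto h f)
  refine tendsto_nhds_unique h3 ((h1.add h2).congr fun n => ?_)
  have e : BddLipFun.mul (χ n + ψ n) f = BddLipFun.mul (χ n) f + BddLipFun.mul (ψ n) f := by
    ext x; simp [BddLipFun.mul, add_mul]
  simp [e]

theorem restrict_apply_of_eq_univ (T : MetricCurrent X) {B : Set X} (hB : MeasurableSet B)
    (h : B = univ) (f : BddLipFun X) (π : LipFun X) :
    (T.restrict hB).toFun f π = T.toFun f π := by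
  have h0 : ControlledBy (0 : BddLipFun X →ₗ[ℝ] LipFun X →ₗ[ℝ] ℝ) (0 : Measure X) := by
    intro f π K _; simp
  rw [T.restrict_eq_of_add hB T.controlledBy_controlMeasure h0 (add_zero _).symm
    (by simp [h]) (by simp)]

theorem restrict_add_restrict_compl_apply (T : MetricCurrent X) {B : Set X}
    (hB : MeasurableSet B) (f : BddLipFun X) (π : LipFun X) :
    (T.restrict hB).toFun f π + (T.restrict hB.compl).toFun f π = T.toFun f π := by
  rw [← T.restrict_union_apply hB hB.compl disjoint_compl_right,
    T.restrict_apply_of_eq_univ _ (union_compl_self B)]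

/-- Controlling measures can be glued along a countable measurable partition. -/
theorem controlledBy_sum_restrict (T : MetricCurrent X) {t : ℕ → Set X}
    (ht : ∀ n, MeasurableSet (t n)) (hd : Pairwise (Function.onFun Disjoint t))
    (hU : ⋃ n, t n = univ) {μ : ℕ → Measure X} (hfin : ∀ n, IsFiniteMeasure (μ n))
    (hμ : ∀ n, ControlledBy T.toFun (μ n))
    [IsFiniteMeasure (Measure.sum fun n => (μ n).restrict (t n))] :
    ControlledBy T.toFun (Measure.sum fun n => (μ n).restrict (t n)) := by
  refine controlledBy_of_enorm_le fun f π K hK => ?_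
  set A : ℕ → Set X := fun N => ⋃ i ∈ Finset.range N, t i with hA
  have hAm : ∀ N, MeasurableSet (A N) := fun N => Finset.measurableSet_biUnion _ fun i _ => ht i
  have hAr : ∀ N, (T.restrict (hAm N)).toFun f π
      = ∑ i ∈ Finset.range N, (T.restrict (ht i)).toFun f π := by
    intro N
    induction N with
    | zero =>
      have := T.enorm_restrict_le (hAm 0) T.controlledBy_controlMeasure f π hK
      have h0 : A 0 = ∅ := by simp [hA]
      have h1 : ∫⁻ x in A 0, ‖f.1 x‖ₑ ∂T.controlMeasure = 0 := by rw [h0]; simp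
      rw [h1, mul_zero, nonpos_iff_eq_zero, enorm_eq_zero] at this
      simpa using this
    | succ N ih =>
      rw [Finset.sum_range_succ, ← ih]
      have hdis : Disjoint (A N) (t N) := by
        simp only [hA, Set.disjoint_iUnion_left, Finset.mem_range]
        exact fun i hi => hd hi.ne
      rw [← T.restrict_union_apply (hAm N) (ht N) hdis]
      have : A (N + 1) = A N ∪ t N := by
        simp only [hA, Finset.range_add_one, Finset.set_biUnion_insert]
        rw [union_comm]
      simp only [this]
  obtain ⟨M, hM⟩ := f.2.2
  set ν := T.controlMeasure
  -- The first `N` pieces are estimated each by its own `μ n`; the remainder by the single finite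
  -- measure `ν`, whose mass off `A N` tends to zero.
  have hle : ∀ N, ‖T.toFun f π‖ₑ ≤ K * ∫⁻ x, ‖f.1 x‖ₑ ∂(Measure.sum fun n => (μ n).restrict (t n))
      + K * (ENNReal.ofReal M * ν (A N)ᶜ) := by
    intro N
    rw [← T.restrict_add_restrict_compl_apply (hAm N)]
    refine (enorm_add_le _ _).trans (add_le_add ?_ ?_)
    · rw [hAr, lintegral_sum_measure]
      calc _ ≤ ∑ i ∈ Finset.range N, ‖(T.restrict (ht i)).toFun f π‖ₑ := enorm_sum_le _ _
        _ ≤ ∑ i ∈ Finset.range N, K * ∫⁻ x in t i, ‖f.1 x‖ₑ ∂(μ i) :=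
          Finset.sum_le_sum fun i _ => T.enorm_restrict_le (ht i) (hμ i) f π hK
        _ = K * ∑ i ∈ Finset.range N, ∫⁻ x in t i, ‖f.1 x‖ₑ ∂(μ i) := by rw [Finset.mul_sum]
        _ ≤ _ := by gcongr; exact ENNReal.sum_le_tsum _
    · refine (T.enorm_restrict_le (hAm N).compl T.controlledBy_controlMeasure f π hK).trans ?_
      gcongr
      rw [← setLIntegral_const]
      refine lintegral_mono fun x => ?_
      rw [← ofReal_norm]
      exact ENNReal.ofReal_le_ofReal (hM x)
  have hlim : Tendsto (fun N => ν (A N)ᶜ) atTop (𝓝 0) := by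
    have hmono : Antitone fun N => (A N)ᶜ := fun m n hmn => by
      refine compl_subset_compl.2 (biUnion_subset_biUnion_left fun i hi => ?_)
      simp only [Finset.coe_range, mem_Iio] at hi ⊢
      exact lt_of_lt_of_le hi hmn
    have := tendsto_measure_iInter_atTop (μ := ν)
      (fun N => (hAm N).compl.nullMeasurableSet) hmono ⟨0, measure_ne_top _ _⟩
    have he : ⋂ N, (A N)ᶜ = ∅ := by
      rw [← compl_iUnion, compl_empty_iff, eq_univ_iff_forall]
      intro x
      have hx : x ∈ ⋃ n, t n := hU ▸ mem_univ x
      obtain ⟨n, hn⟩ := mem_iUnion.1 hx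
      exact mem_iUnion.2 ⟨n + 1, mem_biUnion (by simp) hn⟩
    rwa [he, measure_empty] at this
  have hlim2 : Tendsto (fun N => K * ∫⁻ x, ‖f.1 x‖ₑ ∂(Measure.sum fun n => (μ n).restrict (t n))
      + K * (ENNReal.ofReal M * ν (A N)ᶜ)) atTop
      (𝓝 (K * ∫⁻ x, ‖f.1 x‖ₑ ∂(Measure.sum fun n => (μ n).restrict (t n))
        + K * (ENNReal.ofReal M * 0))) :=
    tendsto_const_nhds.add (ENNReal.Tendsto.const_mul
      (ENNReal.Tendsto.const_mul hlim (Or.inr ENNReal.ofReal_ne_top)) (Or.inr ENNReal.coe_ne_top))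
  rw [mul_zero, mul_zero, add_zero] at hlim2
  exact ge_of_tendsto' hlim2 hle

/-- The mass measure is nearly attained by a controlling measure. -/
theorem exists_controlledBy_le_mass_add (T : MetricCurrent X) {ε : ℝ≥0∞} (hε : ε ≠ 0) :
    ∃ ν : Measure X, IsFiniteMeasure ν ∧ ControlledBy T.toFun ν ∧ ν univ ≤ T.mass + ε := by
  rcases eq_or_ne ε ⊤ with rfl | hεtop
  · exact ⟨T.controlMeasure, inferInstance, T.controlledBy_controlMeasure, by simp⟩
  set m := {μ : Measure X | IsFiniteMeasure μ ∧ ControlledBy T.toFun μ} with hm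
  have hne : m.Nonempty := ⟨_, inferInstance, T.controlledBy_controlMeasure⟩
  have hε2 : ε / 2 ≠ 0 := (ENNReal.half_pos hε).ne'
  have h1 : T.mass < T.mass + ε / 2 :=
    ENNReal.lt_add_right (measure_ne_top T.massMeasure univ) hε2
  -- An infimum of measures is that of the outer measures: every set of a countable cover is
  -- measured by the cheapest controlling measure. A nearly optimal cover with nearly optimal
  -- measures is then glued.
  have h2 : T.mass = ⨅ (t : ℕ → Set X) (_ : univ ⊆ iUnion t),
      ∑' n, ⨅ (μ : OuterMeasure X) (_ : μ ∈ Measure.toOuterMeasure '' m), μ (t n) := by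
    rw [← OuterMeasure.sInf_apply (hne.image _), ← Measure.sInf_apply MeasurableSet.univ]
    rfl
  rw [h2] at h1
  obtain ⟨t, h1⟩ := iInf_lt_iff.1 h1
  obtain ⟨htU, h1⟩ := iInf_lt_iff.1 h1
  rw [← h2] at h1
  obtain ⟨δ, hδ0, hδ⟩ := ENNReal.exists_pos_sum_of_countable' hε2 ℕ
  have h3 : ∀ n, ∃ μ ∈ m, μ (t n) ≤
      (⨅ (μ : OuterMeasure X) (_ : μ ∈ Measure.toOuterMeasure '' m), μ (t n)) + δ n := by
    intro n
    set I := ⨅ (μ : OuterMeasure X) (_ : μ ∈ Measure.toOuterMeasure '' m), μ (t n) with hI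
    have hIt : I ≠ ⊤ := by
      refine ne_top_of_le_ne_top (measure_ne_top T.controlMeasure (t n)) ?_
      exact iInf₂_le _ ⟨T.controlMeasure, ⟨inferInstance, T.controlledBy_controlMeasure⟩, rfl⟩
    have : I < I + δ n := ENNReal.lt_add_right hIt (hδ0 n).ne'
    nth_rw 1 [hI] at this
    obtain ⟨μ, h⟩ := iInf_lt_iff.1 this
    obtain ⟨⟨μ', hμ', rfl⟩, h⟩ := iInf_lt_iff.1 h
    exact ⟨μ', hμ', h.le⟩
  choose μ hμm hμ using h3
  -- The sets of the cover need be neither measurable nor disjoint. The hull for `μ n` keeps `μ n (t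
  -- n)`, and disjointing only decreases the measure.
  set s : ℕ → Set X := disjointed fun n => toMeasurable (μ n) (t n) with hs
  have hsm : ∀ n, MeasurableSet (s n) :=
    fun n => MeasurableSet.disjointed (fun n => measurableSet_toMeasurable _ _) n
  have hsU : ⋃ n, s n = univ := by
    rw [hs, iUnion_disjointed]
    exact eq_univ_of_univ_subset (htU.trans (iUnion_mono fun n => subset_toMeasurable _ _))
  have hmass : (Measure.sum fun n => (μ n).restrict (s n)) univ ≤ T.mass + ε := by
    rw [Measure.sum_apply _ MeasurableSet.univ]
    calc ∑' n, (μ n).restrict (s n) univ ≤ ∑' n, ((⨅ (μ : OuterMeasure X)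
            (_ : μ ∈ Measure.toOuterMeasure '' m), μ (t n)) + δ n) := by
          refine ENNReal.tsum_le_tsum fun n => ?_
          rw [Measure.restrict_apply_univ]
          refine (measure_mono (disjointed_subset _ n)).trans ?_
          rw [measure_toMeasurable]
          exact hμ n
      _ ≤ T.mass + ε / 2 + ε / 2 := by
          rw [ENNReal.tsum_add]
          exact add_le_add h1.le hδ.le
      _ = T.mass + ε := by rw [add_assoc, ENNReal.add_halves]
  have hfin : IsFiniteMeasure (Measure.sum fun n => (μ n).restrict (s n)) :=
    ⟨hmass.trans_lt (ENNReal.add_lt_top.2 ⟨measure_lt_top _ _, hεtop.lt_top⟩)⟩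
  exact ⟨_, hfin, T.controlledBy_sum_restrict hsm (disjoint_disjointed _) hsU
    (fun n => (hμm n).1) (fun n => (hμm n).2), hmass⟩

/-- The mass measure controls the current, so it is the least finite controlling measure. -/
theorem controlledBy_massMeasure (T : MetricCurrent X) : ControlledBy T.toFun T.massMeasure := by
  refine controlledBy_of_enorm_le fun f π K hK => ?_
  obtain ⟨M, hM⟩ := f.2.2
  -- A nearly optimal `ν` dominates the mass measure, so their difference is a measure of total mass
  -- at most `1/n` and changes the integral by at most `M/n`. For `n = 0` the error is `⊤`, which is
  -- harmless.
  have key : ∀ n : ℕ, ‖T.toFun f π‖ₑ ≤ K * (∫⁻ x, ‖f.1 x‖ₑ ∂T.massMeasure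
      + ENNReal.ofReal M * ((n : ℝ≥0∞))⁻¹) := by
    intro n
    obtain ⟨ν, hfin, hν, hmass⟩ := T.exists_controlledBy_le_mass_add (ε := ((n : ℝ≥0∞))⁻¹)
      (by simp)
    have hle := T.massMeasure_le hν
    refine (enorm_le_of_controlledBy hν f π hK).trans ?_
    gcongr
    have e : ν = (ν - T.massMeasure) + T.massMeasure := (Measure.sub_add_cancel_of_le hle).symm
    have hsub : (ν - T.massMeasure) univ ≤ ((n : ℝ≥0∞))⁻¹ := by
      rw [Measure.sub_apply MeasurableSet.univ hle]
      exact tsub_le_iff_left.2 hmass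
    calc ∫⁻ x, ‖f.1 x‖ₑ ∂ν = ∫⁻ x, ‖f.1 x‖ₑ ∂(ν - T.massMeasure)
          + ∫⁻ x, ‖f.1 x‖ₑ ∂T.massMeasure := by
          rw [← lintegral_add_measure, ← e]
      _ ≤ ENNReal.ofReal M * ((n : ℝ≥0∞))⁻¹ + ∫⁻ x, ‖f.1 x‖ₑ ∂T.massMeasure := by
          gcongr
          calc ∫⁻ x, ‖f.1 x‖ₑ ∂(ν - T.massMeasure)
              ≤ ∫⁻ _, ENNReal.ofReal M ∂(ν - T.massMeasure) := by
                refine lintegral_mono fun x => ?_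
                rw [← ofReal_norm]
                exact ENNReal.ofReal_le_ofReal (hM x)
            _ = ENNReal.ofReal M * (ν - T.massMeasure) univ := lintegral_const _
            _ ≤ _ := by gcongr
      _ = _ := add_comm _ _
  have hlim : Tendsto (fun n : ℕ => (K : ℝ≥0∞) * (∫⁻ x, ‖f.1 x‖ₑ ∂T.massMeasure
      + ENNReal.ofReal M * ((n : ℝ≥0∞))⁻¹)) atTop (𝓝 (K * (∫⁻ x, ‖f.1 x‖ₑ ∂T.massMeasure
      + ENNReal.ofReal M * 0))) :=
    ENNReal.Tendsto.const_mul (tendsto_const_nhds.add (ENNReal.Tendsto.const_mul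
      ENNReal.tendsto_inv_nat_nhds_zero (Or.inr ENNReal.ofReal_ne_top)))
      (Or.inr ENNReal.coe_ne_top)
  rw [mul_zero, add_zero] at hlim
  exact ge_of_tendsto' hlim key

theorem enorm_boundary_le (T : MetricCurrent X) {μ : Measure X} [IsFiniteMeasure μ]
    (hμ : ControlledBy T.toFun μ) (f : LipFun X) {K : ℝ≥0} (hK : LipschitzWith K f.1) :
    ‖T.boundary f‖ₑ ≤ K * μ univ := by
  refine (enorm_le_of_controlledBy hμ (BddLipFun.one X) f hK).trans (le_of_eq ?_)
  simp [BddLipFun.one]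

theorem boundaryKR_ne_top (T : MetricCurrent X) : T.boundaryKR ≠ ⊤ := by
  refine ne_top_of_le_ne_top (measure_ne_top T.massMeasure univ) (iSup₂_le fun f hf => ?_)
  have := T.enorm_boundary_le T.controlledBy_massMeasure f hf
  rw [ENNReal.coe_one, one_mul] at this
  exact (Real.ofReal_le_enorm _).trans this

/-- The boundary is bounded by its Kantorovich–Rubinstein norm. -/
theorem abs_boundary_le (T : MetricCurrent X) (f : LipFun X) {K : ℝ≥0}
    (hK : LipschitzWith K f.1) : |T.boundary f| ≤ T.boundaryKR.toReal * K := by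
  have key : ∀ g : LipFun X, LipschitzWith K g.1 → T.boundary g ≤ T.boundaryKR.toReal * K := by
    intro g hg
    rcases eq_or_ne K 0 with rfl | hK0
    · have := T.enorm_boundary_le T.controlledBy_massMeasure g hg
      simp only [ENNReal.coe_zero, zero_mul, nonpos_iff_eq_zero, enorm_eq_zero] at this
      simp [this]
    · have h1 : LipschitzWith 1 ((K⁻¹ : ℝ) • g).1 := by
        have := (lipschitzWith_smul (K⁻¹ : ℝ)).comp hg
        have e : ‖(K⁻¹ : ℝ)‖₊ * K = 1 := by
          rw [nnnorm_inv, Real.nnnorm_of_nonneg K.coe_nonneg]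
          exact inv_mul_cancel₀ hK0
        rw [e] at this
        exact this
      have h2 : ENNReal.ofReal (T.boundary ((K⁻¹ : ℝ) • g)) ≤ T.boundaryKR :=
        le_iSup₂_of_le _ h1 le_rfl
      rw [ENNReal.ofReal_le_iff_le_toReal T.boundaryKR_ne_top, map_smul, smul_eq_mul,
        inv_mul_le_iff₀ (by positivity)] at h2
      linarith
  refine abs_le.2 ⟨?_, key f hK⟩
  have := key (-f) hK.neg
  rw [map_neg] at this
  linarith

/-- The lower mass bound for a cycle which contains `T` as a restriction. -/
theorem mass_add_boundaryKR_le (T C : MetricCurrent X) {B : Set X} (hB : MeasurableSet B)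
    (hC : C.IsCycle) (hT : T = C.restrict hB) : T.mass + T.boundaryKR ≤ C.mass := by
  have h1 : T.mass ≤ C.massMeasure B := by
    have := T.massMeasure_le (μ := C.massMeasure.restrict B)
      (hT ▸ C.controlledBy_restrict hB C.controlledBy_massMeasure)
    simpa [mass] using this univ
  have h2 : T.boundaryKR ≤ C.massMeasure Bᶜ := by
    refine iSup₂_le fun f hf => ?_
    have hsum := C.restrict_add_restrict_compl_apply hB (BddLipFun.one X) f
    have h0 : C.toFun (BddLipFun.one X) f = 0 := LinearMap.congr_fun hC f
    have e : T.boundary f = -(C.restrict hB.compl).boundary f := by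
      rw [h0] at hsum
      rw [hT]
      exact eq_neg_of_add_eq_zero_left hsum
    have := (C.restrict hB.compl).enorm_boundary_le
      (C.controlledBy_restrict hB.compl C.controlledBy_massMeasure) f hf
    refine (Real.ofReal_le_enorm _).trans ?_
    rw [e, enorm_neg]
    simpa using this
  calc T.mass + T.boundaryKR ≤ C.massMeasure B + C.massMeasure Bᶜ := add_le_add h1 h2
    _ = C.mass := measure_add_measure_compl hB

end Control

end MetricCurrent

namespace MetricCurrent

/-! ### Locality: the boundary only sees values on its support. -/

section Support

/-- **Ekeland's variational principle**, weak form, for maxima of continuous functions. -/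
theorem exists_forall_le_add_mul_dist {X : Type*} [MetricSpace X] [CompleteSpace X] {u : X → ℝ}
    (hu : Continuous u) {M : ℝ} (hM : ∀ x, u x ≤ M) {η : ℝ} (hη : 0 < η) (x₀ : X) :
    ∃ x, u x₀ ≤ u x ∧ ∀ y, u y ≤ u x + η * dist x y := by
  -- Membership `y ∈ E x` is a preorder. Choosing at each step a near-maximiser of `u` on the
  -- current set makes the sets shrink to a point, beyond which no further gain at slope `η` is
  -- possible.
  set E : X → Set X := fun x => {y | u x + η * dist x y ≤ u y} with hE
  have hself : ∀ x, x ∈ E x := fun x => by simp [hE]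
  have htrans : ∀ {x y z}, y ∈ E x → z ∈ E y → z ∈ E x := by
    intro x y z hy hz
    simp only [hE, mem_ofPred_eq] at hy hz ⊢
    nlinarith [dist_triangle x y z]
  have hstep : ∀ (n : ℕ) (x : X), ∃ y ∈ E x, ∀ z ∈ E x, u z ≤ u y + (1 / 2 : ℝ) ^ n := by
    intro n x
    have hb : BddAbove (u '' E x) := ⟨M, by rintro _ ⟨y, -, rfl⟩; exact hM y⟩
    obtain ⟨_, ⟨y, hy, rfl⟩, hlt⟩ := exists_lt_of_lt_csSup (⟨_, x, hself x, rfl⟩ : (u '' E x).Nonempty)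
      (sub_lt_self (sSup (u '' E x)) (show (0 : ℝ) < (1 / 2) ^ n by positivity))
    exact ⟨y, hy, fun z hz => by linarith [le_csSup hb ⟨z, hz, rfl⟩]⟩
  choose g hgE hg using hstep
  let s : ℕ → X := fun n => Nat.rec x₀ (fun n x => g n x) n
  have hs : ∀ n, s (n + 1) = g n (s n) := fun n => rfl
  have hsE : ∀ n m, n ≤ m → s m ∈ E (s n) := by
    intro n m h
    induction m, h using Nat.le_induction with
    | base => exact hself _
    | succ m _ ih => exact htrans ih (by rw [hs]; exact hgE _ _)
  have hdist : ∀ n, ∀ z ∈ E (s (n + 1)), dist (s (n + 1)) z ≤ 1 / η * (1 / 2 : ℝ) ^ n := by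
    intro n z hz
    have h1 := hg n (s n) z (htrans (hsE n (n + 1) (Nat.le_succ n)) hz)
    rw [← hs] at h1
    have h2 : u (s (n + 1)) + η * dist (s (n + 1)) z ≤ u z := hz
    rw [one_div, ← div_eq_inv_mul, le_div_iff₀ hη]
    linarith
  have hc : CauchySeq fun n => s (n + 1) :=
    cauchySeq_of_le_geometric (1 / 2) (1 / η) (by norm_num)
      fun n => hdist n _ (hsE (n + 1) (n + 2) (Nat.le_succ _))
  obtain ⟨x, hx⟩ := cauchySeq_tendsto_of_complete hc
  have hxE : ∀ n, x ∈ E (s n) := by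
    intro n
    refine le_of_tendsto_of_tendsto (tendsto_const_nhds.add ((tendsto_const_nhds.dist hx).const_mul η))
      ((hu.tendsto x).comp hx) ?_
    filter_upwards [eventually_ge_atTop n] with m hm
    exact hsE n (m + 1) (hm.trans (Nat.le_succ m))
  refine ⟨x, ?_, fun y => ?_⟩
  · have : u x₀ + η * dist x₀ x ≤ u x := hxE 0
    nlinarith [dist_nonneg (x := x₀) (y := x)]
  · by_contra! hlt
    have hy : y ∈ E x := hlt.le
    have h0 : Tendsto (fun n : ℕ => 1 / η * (1 / 2 : ℝ) ^ n) atTop (𝓝 0) := by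
      have := (tendsto_pow_atTop_nhds_zero_of_lt_one (by norm_num : (0 : ℝ) ≤ 1 / 2)
        (by norm_num)).const_mul (1 / η)
      simpa using this
    have h1 : dist x y ≤ 0 :=
      le_of_tendsto_of_tendsto' (hx.dist tendsto_const_nhds) h0
        fun n => hdist n y (htrans (hxE (n + 1)) hy)
    have : x = y := dist_le_zero.1 h1
    subst this
    simp at hlt

/-- Pointwise convergence of uniformly Lipschitz functions can be checked on a dense set. -/
theorem tendsto_of_lipschitzWith_of_dense {X : Type*} [PseudoMetricSpace X] {K : ℝ≥0}
    {h : ℕ → X → ℝ} {H : X → ℝ} (hh : ∀ n, LipschitzWith K (h n)) (hH : LipschitzWith K H)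
    {D : Set X} (hD : Dense D) (hlim : ∀ x ∈ D, Tendsto (fun n => h n x) atTop (𝓝 (H x))) (x : X) :
    Tendsto (fun n => h n x) atTop (𝓝 (H x)) := by
  rw [Metric.tendsto_atTop]
  intro ε hε
  obtain ⟨y, hyD, hy⟩ := hD.exists_dist_lt x (show 0 < ε / (3 * (K + 1)) by positivity)
  obtain ⟨N, hN⟩ := Metric.tendsto_atTop.1 (hlim y hyD) (ε / 3) (by positivity)
  refine ⟨N, fun n hn => ?_⟩
  have hK : (K : ℝ) * dist x y ≤ ε / 3 := by
    rw [lt_div_iff₀ (by positivity)] at hy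
    nlinarith [dist_nonneg (x := x) (y := y), K.coe_nonneg]
  calc dist (h n x) (H x) ≤ dist (h n x) (h n y) + dist (h n y) (H y) + dist (H y) (H x) :=
        dist_triangle4 _ _ _ _
    _ < ε / 3 + ε / 3 + ε / 3 := by
        have h1 := (hh n).dist_le_mul x y
        have h2 := hH.dist_le_mul y x
        rw [dist_comm y x] at h2
        have h3 := hN n hn
        linarith
    _ = ε := by ring

variable {X : Type*} [MetricSpace X]

/-- Sequential continuity with respect to bounded pointwise convergence of Lipschitz functions. -/
def IsPointwiseCont (ℓ : LipFun X →ₗ[ℝ] ℝ) : Prop :=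
  ∀ (π : ℕ → LipFun X) (π₀ : LipFun X) (K : ℝ≥0), (∀ j, LipschitzWith K (π j).1) →
    (∀ x, Tendsto (fun j => (π j).1 x) atTop (𝓝 (π₀.1 x))) →
    Tendsto (fun j => ℓ (π j)) atTop (𝓝 (ℓ π₀))

theorem IsPointwiseCont.sub {ℓ m : LipFun X →ₗ[ℝ] ℝ} (hℓ : IsPointwiseCont ℓ)
    (hm : IsPointwiseCont m) : IsPointwiseCont (ℓ - m) :=
  fun π π₀ K h1 h2 => (hℓ π π₀ K h1 h2).sub (hm π π₀ K h1 h2)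

/-- A pointwise limit of a chain of functions with the same Lipschitz constant is the limit of a
sequence in the chain. -/
theorem exists_seq_tendsto_of_isChain [TopologicalSpace.SeparableSpace X] [Nonempty X]
    {c : Set (X → ℝ)} (hc : IsChain (· ≤ ·) c) (hne : c.Nonempty) {K : ℝ≥0}
    (hK : ∀ h ∈ c, LipschitzWith K h) {g : X → ℝ} (hg : ∀ h ∈ c, h ≤ g) :
    ∃ H : X → ℝ, LipschitzWith K H ∧ (∀ h ∈ c, h ≤ H) ∧ H ≤ g ∧
      ∃ s : ℕ → X → ℝ, (∀ n, s n ∈ c) ∧ ∀ x, Tendsto (fun n => s n x) atTop (𝓝 (H x)) := by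
  set H : X → ℝ := fun x => sSup ((fun h : X → ℝ => h x) '' c) with hHdef
  have hb : ∀ x, BddAbove ((fun h : X → ℝ => h x) '' c) :=
    fun x => ⟨g x, by rintro _ ⟨h, hh, rfl⟩; exact hg h hh x⟩
  have hle : ∀ h ∈ c, h ≤ H := fun h hh x => le_csSup (hb x) ⟨h, hh, rfl⟩
  have hHL : LipschitzWith K H := by
    refine LipschitzWith.of_le_add_mul K fun x y => csSup_le (hne.image _) ?_
    rintro _ ⟨h, hh, rfl⟩
    have h1 := (hK h hh).dist_le_mul x y
    rw [Real.dist_eq] at h1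
    have := (abs_le.1 h1).2
    have := hle h hh y
    simp only
    linarith
  -- Since `c` is totally ordered, one member can be almost equal to the supremum at finitely many
  -- points at once. Exhausting a dense sequence then gives `s`.
  have hfin : ∀ ε : ℝ, 0 < ε → ∀ t : Finset X, ∃ h ∈ c, ∀ x ∈ t, H x - ε ≤ h x := by
    intro ε hε t
    classical
    induction t using Finset.induction_on with
    | empty => exact ⟨hne.some, hne.some_mem, by simp⟩
    | insert a t _ ih =>
      obtain ⟨h, hh, hht⟩ := ih
      obtain ⟨_, ⟨k, hk, rfl⟩, hka⟩ := exists_lt_of_lt_csSup (hne.image (fun h : X → ℝ => h a))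
        (sub_lt_self (H a) hε)
      simp only at hka
      rcases hc.total hh hk with hhk | hhk
      · refine ⟨k, hk, fun x hx => ?_⟩
        rcases Finset.mem_insert.1 hx with rfl | hx
        · exact hka.le
        · exact (hht x hx).trans (hhk x)
      · refine ⟨h, hh, fun x hx => ?_⟩
        rcases Finset.mem_insert.1 hx with rfl | hx
        · exact hka.le.trans (hhk x)
        · exact hht x hx
  have hseq : ∀ n : ℕ, ∃ h ∈ c, ∀ i ≤ n,
      H (TopologicalSpace.denseSeq X i) - 1 / ((n : ℝ) + 1)
        ≤ h (TopologicalSpace.denseSeq X i) := by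
    intro n
    classical
    obtain ⟨h, hh, hh'⟩ := hfin (1 / ((n : ℝ) + 1)) (by positivity)
      ((Finset.range (n + 1)).image (TopologicalSpace.denseSeq X))
    exact ⟨h, hh, fun i hi => hh' _ (Finset.mem_image_of_mem _ (by simp; omega))⟩
  choose s hsc hs using hseq
  refine ⟨H, hHL, hle, fun x => csSup_le (hne.image _) ?_, s, hsc, ?_⟩
  · rintro _ ⟨h, hh, rfl⟩
    exact hg h hh x
  · refine tendsto_of_lipschitzWith_of_dense (fun n => hK _ (hsc n)) hHL
      (TopologicalSpace.denseRange_denseSeq X) ?_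
    rintro _ ⟨i, rfl⟩
    refine tendsto_of_tendsto_of_tendsto_of_le_of_le'
      (g := fun n : ℕ => H (TopologicalSpace.denseSeq X i) - 1 / ((n : ℝ) + 1)) ?_
      tendsto_const_nhds ?_ (Eventually.of_forall fun n => hle _ (hsc n) _)
    · simpa using tendsto_one_div_add_atTop_nhds_zero_nat.const_sub
        (H (TopologicalSpace.denseSeq X i))
    · filter_upwards [eventually_ge_atTop i] with n hn
      exact hs n i hn

/-- A functional which vanishes locally off `S` vanishes on bounded non-negative Lipschitz
functions which are zero on `S`. -/
theorem apply_eq_zero_of_nonneg_of_le [CompleteSpace X] [TopologicalSpace.SeparableSpace X]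
    {ℓ : LipFun X →ₗ[ℝ] ℝ} (hℓ : IsPointwiseCont ℓ) {S : Set X}
    (hS : ∀ x ∉ S, ∃ U ∈ 𝓝 x, ∀ f : LipFun X, f.1 ∈ BddLipFun X → tsupport f.1 ⊆ U → ℓ f = 0)
    (g : LipFun X) (hg0 : ∀ x, 0 ≤ g.1 x) {M : ℝ} (hgM : ∀ x, g.1 x ≤ M)
    (hgS : ∀ x ∈ S, g.1 x = 0) : ℓ g = 0 := by
  rcases isEmpty_or_nonempty X with hX | hX
  · have : g = 0 := by ext x; exact hX.elim x
    simp [this]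
  obtain ⟨L, hL0, hL⟩ : ∃ L : ℝ≥0, 0 < L ∧ LipschitzWith L g.1 := by
    obtain ⟨L, hL⟩ := g.2
    exact ⟨L + 1, by positivity, hL.weaken (le_add_of_nonneg_right zero_le_one)⟩
  -- Zorn's lemma builds `g` from below by local modifications. The constant `2 * L`, larger than
  -- that of `g`, leaves room for adding steep cones, and a uniform bound makes `ℓ` continuous along
  -- chains.
  set P : Set (X → ℝ) := {h | LipschitzWith (2 * L) h ∧ (∀ x, 0 ≤ h x) ∧ h ≤ g.1 ∧
    ∀ k : LipFun X, k.1 = h → ℓ k = 0} with hP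
  have h0P : (0 : X → ℝ) ∈ P := by
    refine ⟨LipschitzWith.const' 0, fun _ => le_rfl, hg0, fun k hk => ?_⟩
    have : k = 0 := Subtype.ext hk
    simp [this]
  obtain ⟨F, -, hF⟩ := zorn_le_nonempty₀ P (by
    intro c hcP hc y hy
    obtain ⟨H, hHL, hcH, hHg, s, hsc, hs⟩ := exists_seq_tendsto_of_isChain hc ⟨y, hy⟩
      (fun h hh => (hcP hh).1) (fun h hh => (hcP hh).2.2.1)
    refine ⟨H, ⟨hHL, fun x => ((hcP hy).2.1 x).trans (hcH y hy x), hHg, fun k hk => ?_⟩, hcH⟩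
    have := hℓ (fun n => ⟨s n, _, (hcP (hsc n)).1⟩) k _ (fun n => (hcP (hsc n)).1)
      (fun x => by rw [hk]; exact hs x)
    refine tendsto_nhds_unique this (tendsto_const_nhds.congr fun n => ?_)
    exact ((hcP (hsc n)).2.2.2 _ rfl).symm) 0 h0P
  obtain ⟨hFL, hF0, hFg, hFℓ⟩ := hF.1
  suffices hFeq : g.1 = F from hFℓ g hFeq
  by_contra hne
  obtain ⟨x₀, hx₀⟩ : ∃ x₀, F x₀ < g.1 x₀ := by
    by_contra! h
    exact hne (le_antisymm h hFg)
  have hL0' : (0 : ℝ) < L := hL0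
  -- At such a point `g - F` is positive, so `x ∉ S`, and it grows at slope at most `L / 2`. As `g`
  -- is `L`-Lipschitz, `F` descends from `x` at slope at most `3L/2`, which a cone of slope `2L`
  -- undercuts.
  obtain ⟨x, hx1, hx2⟩ := exists_forall_le_add_mul_dist (u := fun x => g.1 x - F x)
    (hL.continuous.sub hFL.continuous) (M := M) (fun x => by linarith [hgM x, hF0 x])
    (η := L / 2) (by positivity) x₀
  have hxS : x ∉ S := fun h => by linarith [hgS x h, hF0 x]
  obtain ⟨U, hU, hUℓ⟩ := hS x hxS
  obtain ⟨r, hr, hrU⟩ := Metric.mem_nhds_iff.1 hU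
  -- With this height the cone `F x + s - 2L d` is below `F x - (3/2) L d`, hence below `F`, as soon
  -- as `d ≥ r / 2`. So the bump added to `F` is supported in `U`.
  set s : ℝ := L * r / 4 with hs
  have hs0 : 0 < s := by positivity
  set b : X → ℝ := fun y => F x + s - 2 * L * dist x y with hbdef
  set F' : X → ℝ := fun y => max (F y) (min (g.1 y) (b y)) with hF'
  have hbL : LipschitzWith (2 * L) b := by
    refine LipschitzWith.of_le_add_mul _ fun y z => ?_
    have := dist_triangle x y z
    simp only [hbdef]
    push_cast
    nlinarith
  have hF'L : LipschitzWith (2 * L) F' := by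
    have h1 := hFL.max ((hL.weaken (le_mul_of_one_le_left L.2 one_le_two)).min hbL)
    simpa using h1
  have hsupp : ∀ y, y ∉ Metric.closedBall x (r / 2) → F' y - F y = 0 := by
    intro y hy
    rw [Metric.mem_closedBall, not_le, dist_comm] at hy
    have hby : b y ≤ F y := by
      have h1 := hx2 y
      have h2 := hL.dist_le_mul x y
      rw [Real.dist_eq] at h2
      have h3 := (abs_le.1 h2).2
      simp only [hbdef, hs]
      nlinarith
    rw [sub_eq_zero]
    exact max_eq_left ((min_le_right _ _).trans hby)
  have hF'P : F' ∈ P := by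
    refine ⟨hF'L, fun y => (hF0 y).trans (le_max_left _ _),
      fun y => max_le (hFg y) (min_le_left _ _), fun k hk => ?_⟩
    set F₀ : LipFun X := ⟨F, _, hFL⟩
    have hd : ℓ (k - F₀) = 0 := by
      refine hUℓ _ ⟨(k - F₀).2, M, fun y => ?_⟩ ?_
      · have h1 : F y ≤ F' y := le_max_left _ _
        have h2 : F' y ≤ g.1 y := max_le (hFg y) (min_le_left _ _)
        change |k.1 y - F y| ≤ M
        rw [hk, abs_of_nonneg (sub_nonneg.2 h1)]
        linarith [hgM y, hF0 y]
      · refine (closure_minimal (fun y hy => ?_) Metric.isClosed_closedBall).trans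
          ((Metric.closedBall_subset_ball (half_lt_self hr)).trans hrU)
        by_contra hyB
        refine hy ?_
        change k.1 y - F y = 0
        rw [hk]
        exact hsupp y hyB
    rw [map_sub, hFℓ F₀ rfl, sub_zero] at hd
    exact hd
  have hlt : F x < F' x := by
    refine lt_max_of_lt_right (lt_min (by linarith) ?_)
    simp only [hbdef, dist_self]
    linarith
  exact absurd (hF.2 hF'P (fun y => le_max_left _ _) x) (not_le.2 hlt)

/-- A functional which vanishes locally off `S` only depends on the values on `S`. -/
theorem apply_eq_zero_of_eqOn_zero [CompleteSpace X] [TopologicalSpace.SeparableSpace X]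
    {ℓ : LipFun X →ₗ[ℝ] ℝ} (hℓ : IsPointwiseCont ℓ) {S : Set X}
    (hS : ∀ x ∉ S, ∃ U ∈ 𝓝 x, ∀ f : LipFun X, f.1 ∈ BddLipFun X → tsupport f.1 ⊆ U → ℓ f = 0)
    (f : LipFun X) (hf : ∀ x ∈ S, f.1 x = 0) : ℓ f = 0 := by
  have hpos : ∀ g : LipFun X, (∀ x, 0 ≤ g.1 x) → (∀ x ∈ S, g.1 x = 0) → ℓ g = 0 := by
    intro g hg0 hgS
    obtain ⟨L, hL⟩ := g.2
    -- The bounded case relies on Ekeland's principle, which needs an upper bound; truncation is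
    -- removed by pointwise continuity.
    have hmin : ∀ n : ℕ, LipschitzWith L fun x => min (g.1 x) (n : ℝ) :=
      fun n => hL.min_const _
    have hlim := hℓ (fun n => ⟨fun x => min (g.1 x) (n : ℝ), _, hmin n⟩) g L hmin (fun x => by
      obtain ⟨N, hN⟩ := exists_nat_ge (g.1 x)
      refine tendsto_const_nhds.congr' ?_
      filter_upwards [eventually_ge_atTop N] with n hn
      exact (min_eq_left (hN.trans (Nat.cast_le.2 hn))).symm)
    refine tendsto_nhds_unique hlim (tendsto_const_nhds.congr fun n => ?_)
    exact (apply_eq_zero_of_nonneg_of_le hℓ hS _ (fun x => le_min (hg0 x) n.cast_nonneg)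
      (M := n) (fun x => min_le_right _ _) (fun x hx => by simp [hgS x hx])).symm
  obtain ⟨L, hL⟩ := f.2
  have h1 := hpos ⟨fun x => max (f.1 x) 0, _, hL.max_const 0⟩ (fun x => le_max_right _ _)
    (fun x hx => by simp [hf x hx])
  have h2 := hpos ⟨fun x => max (-f.1 x) 0, _, hL.neg.max_const 0⟩ (fun x => le_max_right _ _)
    (fun x hx => by simp [hf x hx])
  have e : f = (⟨fun x => max (f.1 x) 0, _, hL.max_const 0⟩ : LipFun X)
      - ⟨fun x => max (-f.1 x) 0, _, hL.neg.max_const 0⟩ := by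
    ext x
    change f.1 x = max (f.1 x) 0 - max (-f.1 x) 0
    exact (max_zero_sub_max_neg_zero_eq_self (f.1 x)).symm
  rw [e, map_sub, h1, h2, sub_zero]

theorem isPointwiseCont_boundary [MeasurableSpace X] (T : MetricCurrent X) :
    IsPointwiseCont T.boundary :=
  fun π π₀ K => T.continuity _ π π₀ K

/-- The boundary of a current is determined by the values on its support. -/
theorem boundary_apply_eq_zero [CompleteSpace X] [TopologicalSpace.SeparableSpace X]
    [MeasurableSpace X] (T : MetricCurrent X) (f : LipFun X)
    (hf : ∀ x ∈ T.boundarySpt, f.1 x = 0) : T.boundary f = 0 := by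
  refine apply_eq_zero_of_eqOn_zero T.isPointwiseCont_boundary (fun x hx => ?_) f hf
  simp only [boundarySpt, mem_ofPred_eq, not_forall] at hx
  obtain ⟨U, hU, h⟩ := hx
  refine ⟨U, hU, fun f hf hfU => ?_⟩
  by_contra hne
  exact h ⟨f, hf, hfU, hne⟩

end Support

end MetricCurrent

namespace MetricCurrent

/-! ### Decomposition of flat functionals into dipoles. -/

section Decomposition

/-- A uniformly Lipschitz sequence of functions on a separable space, bounded at one point, has a
pointwise convergent subsequence. -/
theorem exists_subseq_tendsto_of_lipschitzWith {X : Type*} [PseudoMetricSpace X]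
    [TopologicalSpace.SeparableSpace X] {K : ℝ≥0} {h : ℕ → X → ℝ} (hh : ∀ n, LipschitzWith K (h n))
    {x₀ : X} {M : ℝ} (hM : ∀ n, |h n x₀| ≤ M) :
    ∃ (H : X → ℝ) (φ : ℕ → ℕ), LipschitzWith K H ∧ StrictMono φ ∧
      ∀ x, Tendsto (fun n => h (φ n) x) atTop (𝓝 (H x)) := by
  have : Nonempty X := ⟨x₀⟩
  set e := TopologicalSpace.denseSeq X
  -- Tychonoff's theorem on the values along a dense sequence replaces the diagonal extraction of
  -- Arzelà-Ascoli.
  have hcomp : IsCompact (Set.pi univ fun i : ℕ =>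
      Icc (-(M + K * dist (e i) x₀)) (M + K * dist (e i) x₀)) :=
    isCompact_univ_pi fun i => isCompact_Icc
  obtain ⟨w, -, φ, hφ, hw⟩ := hcomp.tendsto_subseq (x := fun n i => h n (e i)) (by
    intro n i _
    rw [mem_Icc, ← abs_le]
    have h1 := (hh n).dist_le_mul (e i) x₀
    rw [Real.dist_eq] at h1
    have h2 := hM n
    calc |h n (e i)| = |(h n (e i) - h n x₀) + h n x₀| := by rw [sub_add_cancel]
      _ ≤ |h n (e i) - h n x₀| + |h n x₀| := abs_add_le _ _
      _ ≤ _ := by linarith)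
  have hc : ∀ x, CauchySeq fun n => h (φ n) x := by
    intro x
    rw [Metric.cauchySeq_iff]
    intro ε hε
    obtain ⟨i, hy⟩ := (TopologicalSpace.denseRange_denseSeq X).exists_dist_lt x
      (show 0 < ε / (3 * (K + 1)) by positivity)
    obtain ⟨N, hN⟩ := Metric.cauchySeq_iff.1 ((tendsto_pi_nhds.1 hw i).cauchySeq) (ε / 3)
      (by positivity)
    refine ⟨N, fun m hm n hn => ?_⟩
    have hK : (K : ℝ) * dist x (e i) ≤ ε / 3 := by
      rw [lt_div_iff₀ (by positivity)] at hy
      nlinarith [dist_nonneg (x := x) (y := e i), K.coe_nonneg]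
    have h1 := (hh (φ m)).dist_le_mul x (e i)
    have h2 := (hh (φ n)).dist_le_mul (e i) x
    rw [dist_comm (e i) x] at h2
    have h3 := hN m hm n hn
    have h4 := dist_triangle4 (h (φ m) x) (h (φ m) (e i)) (h (φ n) (e i)) (h (φ n) x)
    simp only [Function.comp_apply] at h3
    linarith
  choose H hH using fun x => cauchySeq_tendsto_of_complete (hc x)
  refine ⟨H, φ, LipschitzWith.of_dist_le_mul fun x y => ?_, hφ, hH⟩
  exact le_of_tendsto ((hH x).dist (hH y)) (Eventually.of_forall fun n => (hh _).dist_le_mul x y)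

variable {X : Type*} [MetricSpace X]

/-- The best Lipschitz constant. -/
noncomputable def lipConst (f : LipFun X) : ℝ≥0 := sInf {K : ℝ≥0 | LipschitzWith K f.1}

theorem lipConst_le {f : LipFun X} {K : ℝ≥0} (h : LipschitzWith K f.1) : lipConst f ≤ K :=
  csInf_le' h

theorem lipschitzWith_lipConst (f : LipFun X) : LipschitzWith (lipConst f) f.1 := by
  refine LipschitzWith.of_dist_le_mul fun x y => ?_
  rcases eq_or_ne x y with rfl | hxy
  · simp
  have hpos : 0 < nndist x y := by
    rw [pos_iff_ne_zero, Ne, nndist_eq_zero]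
    exact hxy
  have : nndist (f.1 x) (f.1 y) / nndist x y ≤ lipConst f := by
    refine le_csInf f.2 fun K hK => ?_
    rw [div_le_iff₀ hpos]
    exact hK.nndist_le x y
  rw [div_le_iff₀ hpos] at this
  exact_mod_cast this

theorem lipConst_add_le (f g : LipFun X) : lipConst (f + g) ≤ lipConst f + lipConst g :=
  lipConst_le ((lipschitzWith_lipConst f).add (lipschitzWith_lipConst g))

theorem lipConst_smul_le (c : ℝ) (f : LipFun X) : lipConst (c • f) ≤ ‖c‖₊ * lipConst f :=
  lipConst_le ((lipschitzWith_smul c).comp (lipschitzWith_lipConst f))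

theorem lipConst_smul {c : ℝ} (hc : 0 < c) (f : LipFun X) :
    (lipConst (c • f) : ℝ) = c * lipConst f := by
  have hcn : (‖c‖₊ : ℝ) = c := by rw [coe_nnnorm, Real.norm_of_nonneg hc.le]
  refine le_antisymm ?_ ?_
  · have := NNReal.coe_le_coe.2 (lipConst_smul_le c f)
    rwa [NNReal.coe_mul, hcn] at this
  · have := NNReal.coe_le_coe.2 (lipConst_smul_le c⁻¹ (c • f))
    rw [smul_smul, inv_mul_cancel₀ hc.ne', one_smul, NNReal.coe_mul, nnnorm_inv, NNReal.coe_inv,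
      hcn, ← div_eq_inv_mul, le_div_iff₀ hc] at this
    linarith

theorem lipConst_zero : lipConst (0 : LipFun X) = 0 :=
  nonpos_iff_eq_zero.1 (lipConst_le (LipschitzWith.const 0))

theorem lipConst_neg (f : LipFun X) : lipConst (-f) = lipConst f :=
  le_antisymm (lipConst_le (lipschitzWith_lipConst f).neg)
    (lipConst_le (by simpa using (lipschitzWith_lipConst (-f)).neg))

/-- The functional `f ↦ f p - f q`. -/
def evalSub (p q : X) : LipFun X →ₗ[ℝ] ℝ where
  toFun f := f.1 p - f.1 q
  map_add' f g := by simp; ring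
  map_smul' c f := by simp; ring

/-- A functional vanishing on functions that vanish on `S`, pointwise continuous on uniformly
Lipschitz sequences, with dual Lipschitz norm at most `κ`. -/
structure IsFlat (S : Set X) (κ : ℝ) (ℓ : LipFun X →ₗ[ℝ] ℝ) : Prop where
  cont : IsPointwiseCont ℓ
  eq_zero : ∀ f : LipFun X, (∀ x ∈ S, f.1 x = 0) → ℓ f = 0
  bound : ∀ f : LipFun X, |ℓ f| ≤ κ * lipConst f

theorem IsFlat.abs_le_of_lipschitzWith {S : Set X} {κ : ℝ} {ℓ : LipFun X →ₗ[ℝ] ℝ}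
    (h : IsFlat S κ ℓ) (hκ : 0 ≤ κ) {f : LipFun X} {K : ℝ≥0} (hK : LipschitzWith K f.1) :
    |ℓ f| ≤ κ * K :=
  (h.bound f).trans (mul_le_mul_of_nonneg_left (NNReal.coe_le_coe.2 (lipConst_le hK)) hκ)

/-- A flat functional is small on Lipschitz functions vanishing on a suitable finite subset. -/
theorem IsFlat.exists_finset [TopologicalSpace.SeparableSpace X] {S : Set X} {κ : ℝ}
    {ℓ : LipFun X →ₗ[ℝ] ℝ} (h : IsFlat S κ ℓ) (hSne : S.Nonempty) {η : ℝ} (hη : 0 < η) :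
    ∃ t : Finset X, ↑t ⊆ S ∧
      ∀ f : LipFun X, (∀ x ∈ t, f.1 x = 0) → |ℓ f| ≤ η * lipConst f := by
  classical
  have : Nonempty S := hSne.to_subtype
  have : TopologicalSpace.SeparableSpace S :=
    (TopologicalSpace.IsSeparable.of_separableSpace S).separableSpace
  set d : ℕ → S := TopologicalSpace.denseSeq S
  have key : ∃ n : ℕ, ∀ f : LipFun X, LipschitzWith 1 f.1 → (∀ i ≤ n, f.1 (d i) = 0) →
      |ℓ f| ≤ η := by
    -- Otherwise there are 1-Lipschitz functions vanishing at more and more points of a dense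
    -- sequence of `S`, with `ℓ` bounded away from zero. A pointwise limit vanishes on `S`, which
    -- contradicts the continuity of `ℓ`.
    by_contra! hcon
    choose f hf1 hf0 hfη using hcon
    obtain ⟨H, φ, hH, hφ, hlim⟩ := exists_subseq_tendsto_of_lipschitzWith hf1
      (x₀ := (d 0 : X)) (M := 0) (fun n => by rw [hf0 n 0 (Nat.zero_le n)]; simp)
    have hHS : ∀ x ∈ S, H x = 0 := by
      have hd0 : ∀ i, H (d i) = 0 := by
        intro i
        refine tendsto_nhds_unique (hlim (d i)) (tendsto_const_nhds.congr' ?_)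
        filter_upwards [eventually_ge_atTop i] with n hn
        exact (hf0 (φ n) i (hn.trans (hφ.id_le n))).symm
      have hcl : IsClosed {x : S | H x = 0} :=
        isClosed_eq (hH.continuous.comp continuous_subtype_val) continuous_const
      have hall := hcl.closure_subset_iff.2 (show range d ⊆ {x : S | H x = 0} by
        rintro _ ⟨i, rfl⟩; exact hd0 i)
      intro x hx
      exact hall (TopologicalSpace.denseRange_denseSeq S ⟨x, hx⟩)
    have h0 := h.eq_zero ⟨H, _, hH⟩ hHS
    have hl := h.cont (fun n => f (φ n)) ⟨H, _, hH⟩ 1 (fun n => hf1 _) hlim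
    rw [h0] at hl
    have := le_of_tendsto_of_tendsto' tendsto_const_nhds hl.abs fun n => (hfη (φ n)).le
    simp only [abs_zero] at this
    linarith
  obtain ⟨n, hn⟩ := key
  refine ⟨(Finset.range (n + 1)).image fun i => (d i : X), fun x hx => ?_, fun f hf => ?_⟩
  · obtain ⟨i, -, rfl⟩ := Finset.mem_image.1 (Finset.mem_coe.1 hx)
    exact (d i).2
  · have hf' : ∀ i ≤ n, f.1 (d i) = 0 :=
      fun i hi => hf _ (Finset.mem_image.2 ⟨i, by simp; omega, rfl⟩)
    rcases eq_or_ne (lipConst f) 0 with h0 | h0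
    · have := h.bound f
      rw [h0] at this ⊢
      simpa using this
    · have hK : (0 : ℝ) < lipConst f := by positivity
      have h1 := hn (((lipConst f : ℝ)⁻¹) • f) ?_ ?_
      · rw [map_smul, smul_eq_mul, abs_mul, abs_of_pos (inv_pos.2 hK), inv_mul_le_iff₀ hK] at h1
        linarith
      · have h2 : lipConst (((lipConst f : ℝ)⁻¹) • f) ≤ 1 := by
          rw [← NNReal.coe_le_coe, lipConst_smul (inv_pos.2 hK), inv_mul_cancel₀ hK.ne']
          simp
        exact (lipschitzWith_lipConst _).weaken h2
      · intro i hi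
        change (lipConst f : ℝ)⁻¹ * f.1 (d i) = 0
        rw [hf' i hi, mul_zero]

/-- A flat functional is, up to a small error, a finite combination of differences of evaluations
at points of `S`, with optimal total cost. -/
theorem IsFlat.exists_approx [TopologicalSpace.SeparableSpace X] {S : Set X} {κ : ℝ}
    {ℓ : LipFun X →ₗ[ℝ] ℝ} (h : IsFlat S κ ℓ) (hκ : 0 ≤ κ) {η : ℝ} (hη : 0 < η) :
    ∃ (n : ℕ) (a : Fin n → ℝ) (p q : Fin n → X), (∀ i, p i ≠ q i) ∧
      (∀ i, p i ∈ S) ∧ (∀ i, q i ∈ S) ∧ ∑ i, |a i| * dist (p i) (q i) ≤ κ ∧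
      ∀ f : LipFun X, |ℓ f - ∑ i, a i * (f.1 (p i) - f.1 (q i))| ≤ η * lipConst f := by
  classical
  rcases S.eq_empty_or_nonempty with rfl | hSne
  · refine ⟨0, Fin.elim0, Fin.elim0, Fin.elim0, fun i => i.elim0, fun i => i.elim0, fun i => i.elim0,
      by simpa using hκ, fun f => ?_⟩
    rw [h.eq_zero f (by simp)]
    simp only [Finset.univ_eq_empty, Finset.sum_empty, sub_zero, abs_zero]
    positivity
  obtain ⟨t, htS, ht⟩ := h.exists_finset hSne (half_pos hη)
  set ι := {x : t × t // x.1 ≠ x.2}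
  set P : ι → X := fun i => i.1.1
  set Q : ι → X := fun i => i.1.2
  have hPQ : ∀ i, 0 < dist (P i) (Q i) := fun i =>
    dist_pos.2 fun hne => i.2 (Subtype.ext hne)
  set D : LipFun X →ₗ[ℝ] (ι → ℝ) :=
    LinearMap.pi fun i => (dist (P i) (Q i))⁻¹ • evalSub (P i) (Q i) with hD
  have hDapp : ∀ f i, D f i = (dist (P i) (Q i))⁻¹ * (f.1 (P i) - f.1 (Q i)) := fun f i => rfl
  have hDle : ∀ f, ‖D f‖ ≤ lipConst f := by
    intro f
    refine (pi_norm_le_iff_of_nonneg (lipConst f).coe_nonneg).2 fun i => ?_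
    rw [hDapp, Real.norm_eq_abs, abs_mul, abs_of_pos (inv_pos.2 (hPQ i)), inv_mul_le_iff₀ (hPQ i),
      mul_comm]
    exact (lipschitzWith_lipConst f).dist_le_mul (P i) (Q i)
  -- `‖D f‖` is the Lipschitz constant of `f` on `t`. Let `g` extend `f` from `t` with this
  -- constant: `f - g` vanishes on `t` and has constant at most `2 * lipConst f`, which is why `t`
  -- was chosen for `η / 2`.
  have hbound : ∀ f : LipFun X, ℓ f ≤ η * lipConst f + κ * ‖D f‖ := by
    intro f
    have hon : LipschitzOnWith ‖D f‖₊ f.1 (t : Set X) := by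
      refine LipschitzOnWith.of_dist_le_mul fun x hx y hy => ?_
      rcases eq_or_ne x y with rfl | hxy
      · simp
      · have hi := norm_le_pi_norm (D f)
          (⟨(⟨x, hx⟩, ⟨y, hy⟩), fun he => hxy (congrArg Subtype.val he)⟩ : ι)
        rw [hDapp, Real.norm_eq_abs, abs_mul, abs_of_pos (inv_pos.2 (hPQ _)),
          inv_mul_le_iff₀ (hPQ _), mul_comm] at hi
        exact hi
    obtain ⟨g, hg, hfg⟩ := hon.extend_real
    set g' : LipFun X := ⟨g, _, hg⟩
    have h1 := ht (f - g') (fun x hx => sub_eq_zero.2 (hfg hx))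
    have h2 := h.abs_le_of_lipschitzWith hκ (f := g') hg
    have h3 : (lipConst (f - g') : ℝ) ≤ lipConst f + ‖D f‖ := by
      have := lipConst_le (f := f - g') ((lipschitzWith_lipConst f).sub hg)
      exact_mod_cast this
    have h4 : ℓ f = ℓ (f - g') + ℓ g' := by rw [← map_add, sub_add_cancel]
    have h5 := hDle f
    rw [coe_nnnorm] at h2
    nlinarith [le_abs_self (ℓ (f - g')), le_abs_self (ℓ g')]
  -- Extending from the graph of `D` to the product splits `ℓ f = G (f, D f)` into `G (0, D f)`, a
  -- combination of difference quotients, and `G (f, 0)`, an error of size `η * lipConst f`.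
  obtain ⟨G, hGext, hGle⟩ := exists_extension_of_le_sublinear
    (E := LipFun X × (ι → ℝ)) ⟨D.graph, ℓ ∘ₗ LinearMap.fst ℝ _ _ ∘ₗ D.graph.subtype⟩
    (fun x => η * lipConst x.1 + κ * ‖x.2‖)
    (fun c hc x => by
      simp only [Prod.smul_fst, Prod.smul_snd]
      rw [lipConst_smul hc, norm_smul, Real.norm_of_nonneg hc.le]
      ring)
    (fun x y => by
      have h1 := NNReal.coe_le_coe.2 (lipConst_add_le x.1 y.1)
      have h2 := norm_add_le x.2 y.2
      rw [NNReal.coe_add] at h1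
      simp only [Prod.fst_add, Prod.snd_add]
      nlinarith)
    (fun x => by
      have hx : x.1.2 = D x.1.1 := (LinearMap.mem_graph_iff D _).1 x.2
      have := hbound x.1.1
      rw [← hx] at this
      exact this)
  set c : ι → ℝ := fun i => G (0, Pi.single i 1) with hc
  have hcsum : ∀ v : ι → ℝ, G (0, v) = ∑ i, c i * v i := by
    intro v
    have e : ((0, v) : LipFun X × (ι → ℝ)) = ∑ i, v i • (0, Pi.single i 1) := by
      refine Prod.ext ?_ ?_
      · simp [Prod.fst_sum]
      · rw [Prod.snd_sum]
        simp only [Prod.smul_snd]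
        exact pi_eq_sum_univ' v 
    rw [e, map_sum]
    refine Finset.sum_congr rfl fun i _ => ?_
    rw [map_smul, smul_eq_mul, mul_comm]
  -- The dual of the sup norm is the `ℓ¹` norm: test on the vector of signs.
  have hcκ : ∑ i, |c i| ≤ κ := by
    have h1 := hGle (0, fun i => SignType.sign (c i))
    rw [hcsum] at h1
    simp only [lipConst_zero, NNReal.coe_zero, mul_zero, zero_add] at h1
    have h2 : ‖fun i => ((SignType.sign (c i) : SignType) : ℝ)‖ ≤ 1 := by
      refine (pi_norm_le_iff_of_nonneg zero_le_one).2 fun i => ?_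
      rcases lt_trichotomy (c i) 0 with h | h | h <;> simp [h]
    have h3 : ∑ i, |c i| = ∑ i, c i * ((SignType.sign (c i) : SignType) : ℝ) :=
      Finset.sum_congr rfl fun i _ => by rw [mul_comm, sign_mul_self]
    rw [h3]
    nlinarith
  have hdiff : ∀ f : LipFun X, ℓ f - ∑ i, c i * D f i = G (f, 0) := by
    intro f
    have h1 : G (f, D f) = ℓ f := hGext ⟨(f, D f), (LinearMap.mem_graph_iff D _).2 rfl⟩
    rw [← hcsum, ← h1, ← map_sub]
    simp
  set E := Fintype.equivFin ι
  refine ⟨Fintype.card ι, fun i => c (E.symm i) * (dist (P (E.symm i)) (Q (E.symm i)))⁻¹,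
    fun i => P (E.symm i), fun i => Q (E.symm i), fun i => dist_pos.1 (hPQ _), fun i => htS (Subtype.prop _),
    fun i => htS (Subtype.prop _), ?_, fun f => ?_⟩
  · rw [Equiv.sum_comp E.symm fun i => |c i * (dist (P i) (Q i))⁻¹| * dist (P i) (Q i)]
    refine le_trans (le_of_eq (Finset.sum_congr rfl fun i _ => ?_)) hcκ
    rw [abs_mul, abs_of_pos (inv_pos.2 (hPQ i)), mul_assoc, inv_mul_cancel₀ (hPQ i).ne', mul_one]
  · have e : ∑ i, c (E.symm i) * (dist (P (E.symm i)) (Q (E.symm i)))⁻¹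
        * (f.1 (P (E.symm i)) - f.1 (Q (E.symm i))) = ∑ i, c i * D f i := by
      rw [Equiv.sum_comp E.symm fun i => c i * (dist (P i) (Q i))⁻¹ * (f.1 (P i) - f.1 (Q i))]
      exact Finset.sum_congr rfl fun i _ => by rw [hDapp, mul_assoc]
    rw [e, hdiff]
    have h1 := hGle (f, 0)
    have h2 := hGle (-f, 0)
    have h3 : G (-f, 0) = -G (f, 0) := by
      rw [← map_neg]; simp
    rw [h3] at h2
    simp only [lipConst_neg, norm_zero, mul_zero, add_zero] at h1 h2
    exact abs_le.2 ⟨by linarith, h1⟩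

/-- A flat functional is a countable combination of differences of evaluations at points of `S`,
with almost optimal total cost. -/
theorem IsFlat.exists_hasSum [TopologicalSpace.SeparableSpace X] {S : Set X} {κ : ℝ}
    {ℓ : LipFun X →ₗ[ℝ] ℝ} (h : IsFlat S κ ℓ) (hκ : 0 ≤ κ) {ε : ℝ} (hε : 0 < ε) :
    ∃ (ι : Type) (_ : Countable ι) (a : ι → ℝ) (p q : ι → X),
      (∀ i, p i ≠ q i) ∧ (∀ i, p i ∈ S) ∧ (∀ i, q i ∈ S) ∧
      ∑' i, ENNReal.ofReal (|a i| * dist (p i) (q i)) ≤ ENNReal.ofReal (κ + ε) ∧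
      ∀ f : LipFun X, HasSum (fun i => a i * (f.1 (p i) - f.1 (q i))) (ℓ f) := by
  -- `κs n` bounds the norm of the remainder before stage `n`, hence also the cost of that stage.
  -- The terms after the first sum to `ε`.
  set κs : ℕ → ℝ := fun n => Nat.casesOn n κ fun n => ε / 2 / 2 ^ n with hκs
  have hκs0 : ∀ n, 0 ≤ κs n := by
    rintro (_ | n)
    · exact hκ
    · simp only [hκs]; positivity
  have hκpos : ∀ n, 0 < κs (n + 1) := fun n => by simp only [hκs]; positivity
  -- Stated for every `m`, with flatness as a premise inside, so that the choice is a total function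
  -- that can be iterated before flatness of the remainders is known.
  have step : ∀ (n : ℕ) (m : LipFun X →ₗ[ℝ] ℝ), ∃ D : Σ N : ℕ, Fin N → ℝ × X × X,
      IsFlat S (κs n) m → (∀ i, (D.2 i).2.1 ≠ (D.2 i).2.2) ∧ (∀ i, (D.2 i).2.1 ∈ S) ∧ (∀ i, (D.2 i).2.2 ∈ S) ∧
      ∑ i, |(D.2 i).1| * dist (D.2 i).2.1 (D.2 i).2.2 ≤ κs n ∧
      IsFlat S (κs (n + 1)) (m - ∑ i, (D.2 i).1 • evalSub (D.2 i).2.1 (D.2 i).2.2) := by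
    intro n m
    by_cases hm : IsFlat S (κs n) m
    · obtain ⟨N, a, p, q, hpq, hp, hq, hsum, happ⟩ := hm.exists_approx (hκs0 n) (hκpos n)
      have hev : ∀ f : LipFun X, (∑ i, a i • evalSub (p i) (q i)) f
          = ∑ i, a i * (f.1 (p i) - f.1 (q i)) := fun f => by
        rw [LinearMap.sum_apply]; rfl
      refine ⟨⟨N, fun i => (a i, p i, q i)⟩, fun _ => ⟨hpq, hp, hq, hsum, ?_, fun f hf => ?_,
        fun f => ?_⟩⟩
      · refine hm.cont.sub fun π π₀ K _ hπ => ?_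
        simp only [hev]
        exact tendsto_finsetSum _ fun i _ => ((hπ _).sub (hπ _)).const_mul _
      · rw [LinearMap.sub_apply, hm.eq_zero f hf, hev]
        simp [hf _ (hp _), hf _ (hq _)]
      · rw [LinearMap.sub_apply, hev]
        exact happ f
    · exact ⟨⟨0, Fin.elim0⟩, fun hm' => absurd hm' hm⟩
  choose D hD using step
  let m : ℕ → LipFun X →ₗ[ℝ] ℝ := fun n => Nat.rec ℓ
    (fun n m => m - ∑ i, ((D n m).2 i).1 • evalSub ((D n m).2 i).2.1 ((D n m).2 i).2.2) n
  have hmsucc : ∀ n, m (n + 1) = m n - ∑ i, ((D n (m n)).2 i).1 •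
    evalSub ((D n (m n)).2 i).2.1 ((D n (m n)).2 i).2.2 := fun n => rfl
  have hm : ∀ n, IsFlat S (κs n) (m n) := by
    intro n
    induction n with
    | zero => exact h
    | succ n ih => rw [hmsucc]; exact (hD n _ ih).2.2.2.2
  set N : ℕ → ℕ := fun n => (D n (m n)).1
  set A : ∀ n, Fin (N n) → ℝ := fun n i => ((D n (m n)).2 i).1
  set P : ∀ n, Fin (N n) → X := fun n i => ((D n (m n)).2 i).2.1
  set Q : ∀ n, Fin (N n) → X := fun n i => ((D n (m n)).2 i).2.2
  have hκsum : ∑' n, ENNReal.ofReal (κs n) = ENNReal.ofReal (κ + ε) := by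
    have h2 : HasSum (fun n => κs (n + 1)) ε := hasSum_geometric_two' ε
    have h1 : HasSum κs (κ + ε) := by
      have := (hasSum_nat_add_iff (f := κs) 1).1 h2
      simpa [hκs, add_comm] using this
    rw [← ENNReal.ofReal_tsum_of_nonneg hκs0 h1.summable, h1.tsum_eq]
  have hcost : ∑' i : Σ n, Fin (N n), ENNReal.ofReal (|A i.1 i.2| * dist (P i.1 i.2) (Q i.1 i.2))
      ≤ ENNReal.ofReal (κ + ε) := by
    rw [ENNReal.tsum_sigma', ← hκsum]
    refine ENNReal.tsum_le_tsum fun n => ?_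
    rw [tsum_fintype, ← ENNReal.ofReal_sum_of_nonneg fun i _ => by positivity]
    exact ENNReal.ofReal_le_ofReal (hD n _ (hm n)).2.2.2.1
  refine ⟨Σ n, Fin (N n), inferInstance, fun i => A i.1 i.2, fun i => P i.1 i.2,
    fun i => Q i.1 i.2, fun i => (hD _ _ (hm i.1)).1 i.2,
    fun i => (hD _ _ (hm i.1)).2.1 i.2, fun i => (hD _ _ (hm i.1)).2.2.1 i.2, hcost, fun f => ?_⟩
  have hsummable : Summable fun i : Σ n, Fin (N n) =>
      A i.1 i.2 * (f.1 (P i.1 i.2) - f.1 (Q i.1 i.2)) := by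
    have h1 : Summable fun i : Σ n, Fin (N n) => |A i.1 i.2| * dist (P i.1 i.2) (Q i.1 i.2) := by
      have := ENNReal.summable_toReal (ne_top_of_le_ne_top ENNReal.ofReal_ne_top hcost)
      refine this.congr fun i => ENNReal.toReal_ofReal (by positivity)
    refine Summable.of_norm_bounded (h1.mul_left (lipConst f : ℝ)) fun i => ?_
    rw [norm_mul, Real.norm_eq_abs]
    have := (lipschitzWith_lipConst f).dist_le_mul (P i.1 i.2) (Q i.1 i.2)
    rw [dist_eq_norm] at this
    nlinarith [abs_nonneg (A i.1 i.2)]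
  have hstage : ∀ n, ∑ i, A n i * (f.1 (P n i) - f.1 (Q n i)) = m n f - m (n + 1) f := by
    intro n
    rw [hmsucc, LinearMap.sub_apply, sub_sub_cancel, LinearMap.sum_apply]
    rfl
  -- Absolute summability allows summing stage by stage, and the stage sums telescope.
  have hsig := hsummable.hasSum.sigma fun n => hasSum_fintype _
  simp only [hstage] at hsig
  have hlim : Tendsto (fun n => ∑ k ∈ Finset.range n, (m k f - m (k + 1) f)) atTop (𝓝 (ℓ f)) := by
    have h0 : Tendsto (fun n => m n f) atTop (𝓝 0) := by
      rw [← tendsto_add_atTop_iff_nat 1]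
      refine squeeze_zero_norm (a := fun n => κs (n + 1) * lipConst f) (fun n => (hm (n + 1)).bound f) ?_
      have h2 : Tendsto (fun n => κs (n + 1)) atTop (𝓝 0) :=
        (hasSum_geometric_two' ε).summable.tendsto_atTop_zero
      simpa using h2.mul_const (lipConst f : ℝ)
    have e : ∀ n, ∑ k ∈ Finset.range n, (m k f - m (k + 1) f) = ℓ f - m n f := fun n =>
      Finset.sum_range_sub' (fun k => m k f) n
    simp only [e]
    simpa using h0.const_sub (ℓ f)
  rw [← tendsto_nhds_unique hsig.tendsto_sum_nat hlim]
  exact hsummable.hasSum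

/-- Finite mass of `T` alone makes `∂T` flat; `∂T` itself may have infinite mass. -/
theorem isFlat_boundary [CompleteSpace X] [TopologicalSpace.SeparableSpace X] [MeasurableSpace X]
    [BorelSpace X] (T : MetricCurrent X) :
    IsFlat T.boundarySpt T.boundaryKR.toReal T.boundary :=
  ⟨T.isPointwiseCont_boundary, T.boundary_apply_eq_zero,
    fun f => T.abs_boundary_le f (lipschitzWith_lipConst f)⟩

end Decomposition

end MetricCurrent

namespace MetricCurrent

/-! ### Sums, multiples and series of currents. -/

section Algebra

variable {X : Type*} [MetricSpace X] [MeasurableSpace X] [BorelSpace X]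

theorem controlledBy_add {S T : BddLipFun X →ₗ[ℝ] LipFun X →ₗ[ℝ] ℝ} {μ ν : Measure X}
    [IsFiniteMeasure μ] [IsFiniteMeasure ν] (hS : ControlledBy S μ) (hT : ControlledBy T ν) :
    ControlledBy (S + T) (μ + ν) :=
  controlledBy_of_enorm_le fun f π K hK => by
    rw [LinearMap.add_apply, LinearMap.add_apply, lintegral_add_measure, mul_add]
    exact (enorm_add_le _ _).trans (add_le_add (enorm_le_of_controlledBy hS f π hK)
      (enorm_le_of_controlledBy hT f π hK))

theorem controlledBy_smul (c : ℝ) {T : BddLipFun X →ₗ[ℝ] LipFun X →ₗ[ℝ] ℝ} {μ : Measure X}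
    [IsFiniteMeasure μ] (hT : ControlledBy T μ) :
    ControlledBy (c • T) (ENNReal.ofReal |c| • μ) := by
  have := μ.smul_finite (c := ENNReal.ofReal |c|) ENNReal.ofReal_ne_top
  refine controlledBy_of_enorm_le fun f π K hK => ?_
  rw [LinearMap.smul_apply, LinearMap.smul_apply, smul_eq_mul, enorm_mul, lintegral_smul_measure,
    smul_eq_mul, ← Real.norm_eq_abs, ofReal_norm, mul_left_comm]
  gcongr
  exact enorm_le_of_controlledBy hT f π hK

/-- The sum of two currents. -/
def add (S T : MetricCurrent X) : MetricCurrent X where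
  toFun := S.toFun + T.toFun
  finite_mass := ⟨S.controlMeasure + T.controlMeasure, inferInstance,
    controlledBy_add S.controlledBy_controlMeasure T.controlledBy_controlMeasure⟩
  continuity f π π₀ K h1 h2 := (S.continuity f π π₀ K h1 h2).add (T.continuity f π π₀ K h1 h2)
  locality f π h := by
    rw [LinearMap.add_apply, LinearMap.add_apply, S.locality f π h, T.locality f π h, add_zero]

/-- A scalar multiple of a current. -/
def smul (c : ℝ) (T : MetricCurrent X) : MetricCurrent X where
  toFun := c • T.toFun
  finite_mass := ⟨ENNReal.ofReal |c| • T.controlMeasure,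
    Measure.smul_finite _ ENNReal.ofReal_ne_top,
    controlledBy_smul c T.controlledBy_controlMeasure⟩
  continuity f π π₀ K h1 h2 := (T.continuity f π π₀ K h1 h2).const_mul c
  locality f π h := by
    rw [LinearMap.smul_apply, LinearMap.smul_apply, T.locality f π h, smul_zero]

/-- A family of currents with summable controlling measures has a sum. -/
theorem exists_hasSum {ι : Type*} (T : ι → MetricCurrent X) (μ : ι → Measure X)
    (hμ : ∀ i, ControlledBy (T i).toFun (μ i)) [IsFiniteMeasure (Measure.sum μ)] :
    ∃ R : MetricCurrent X, ControlledBy R.toFun (Measure.sum μ) ∧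
      ∀ f π, HasSum (fun i => (T i).toFun f π) (R.toFun f π) := by
  have hfin : ∀ i, IsFiniteMeasure (μ i) :=
    fun i => isFiniteMeasure_of_le _ (Measure.le_sum μ i)
  have hsum : ∀ f : BddLipFun X, ∑' i, ∫⁻ x, ‖f.1 x‖ₑ ∂(μ i) ≠ ⊤ := fun f => by
    rw [← lintegral_sum_measure]
    exact lintegral_bddLip_ne_top _ f
  set b : BddLipFun X → ι → ℝ := fun f i => (∫⁻ x, ‖f.1 x‖ₑ ∂(μ i)).toReal
  have hb : ∀ f, Summable (b f) := fun f => ENNReal.summable_toReal (hsum f)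
  have hle : ∀ i f (π : LipFun X) (K : ℝ≥0), LipschitzWith K π.1 →
      ‖(T i).toFun f π‖ ≤ K * b f i := by
    intro i f π K hK
    refine (hμ i f π K hK).trans (le_of_eq ?_)
    simp only [b]
    rw [← ofReal_integral_bddLip, ENNReal.toReal_ofReal (integral_nonneg fun _ => abs_nonneg _)]
  have hs : ∀ f π, Summable fun i => (T i).toFun f π := by
    intro f π
    obtain ⟨K, hK⟩ := π.2
    exact Summable.of_norm_bounded ((hb f).mul_left (K : ℝ)) fun i => hle i f π K hK
  set F : BddLipFun X →ₗ[ℝ] LipFun X →ₗ[ℝ] ℝ :=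
    LinearMap.mk₂ ℝ (fun f π => ∑' i, (T i).toFun f π)
      (fun f f' π => by
        simp only [map_add, LinearMap.add_apply]
        exact (hs f π).tsum_add (hs f' π))
      (fun c f π => by
        simp only [map_smul, LinearMap.smul_apply]
        exact (hs f π).tsum_const_smul c)
      (fun f π π' => by
        simp only [map_add]
        exact (hs f π).tsum_add (hs f π'))
      (fun c f π => by
        simp only [map_smul]
        exact (hs f π).tsum_const_smul c) with hF
  have hFapp : ∀ f π, F f π = ∑' i, (T i).toFun f π := fun f π => rfl
  have hFc : ControlledBy F (Measure.sum μ) := controlledBy_of_enorm_le fun f π K hK => by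
    rw [hFapp, lintegral_sum_measure, ← ENNReal.tsum_mul_left]
    exact enorm_tsum_le_tsum_enorm.trans
      (ENNReal.tsum_le_tsum fun i => enorm_le_of_controlledBy (hμ i) f π hK)
  refine ⟨⟨F, ⟨_, inferInstance, hFc⟩, fun f π π₀ K hK hπ => ?_, fun f π h => ?_⟩, hFc,
    fun f π => (hs f π).hasSum⟩
  · exact tendsto_tsum_of_dominated_convergence ((hb f).mul_left (K : ℝ))
      (fun i => (T i).continuity f π π₀ K hK hπ)
      (Eventually.of_forall fun j i => hle i f (π j) K (hK j))
  · rw [hFapp]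
    simp [fun i => (T i).locality f π h]

end Algebra

/-! ### The current of an oriented segment. -/

section Segment

variable {X : Type*} [NormedAddCommGroup X] [NormedSpace ℝ X]

theorem lipschitzWith_comp_lineMap {π : X → ℝ} {K : ℝ≥0} (hK : LipschitzWith K π) (p q : X) :
    LipschitzWith (K * nndist p q) fun t : ℝ => π (AffineMap.lineMap p q t) :=
  hK.comp (lipschitzWith_lineMap p q)

theorem continuous_lineMap (p q : X) :
    Continuous fun t : ℝ => (AffineMap.lineMap p q t : X) :=
  (lipschitzWith_lineMap p q).continuous

theorem intervalIntegral_eq_setIntegral_Ioo (F : ℝ → ℝ) :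
    ∫ t in (0 : ℝ)..1, F t = ∫ t in Ioo 0 1, F t := by
  rw [intervalIntegral.integral_of_le zero_le_one, integral_Ioc_eq_integral_Ioo]

theorem ae_differentiableAt_comp_lineMap (p q : X) (π : LipFun X) :
    ∀ᵐ t ∂(volume.restrict (Ioo (0 : ℝ) 1)),
      DifferentiableAt ℝ (fun s : ℝ => π.1 (AffineMap.lineMap p q s)) t := by
  obtain ⟨K, hK⟩ := π.2
  exact ae_restrict_of_ae (lipschitzWith_comp_lineMap hK p q).ae_differentiableAt_real

theorem absolutelyContinuousOnInterval_comp_lineMap (p q : X) {π : X → ℝ} {K : ℝ≥0}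
    (hK : LipschitzWith K π) :
    AbsolutelyContinuousOnInterval (fun s : ℝ => π (AffineMap.lineMap p q s)) 0 1 :=
  ((lipschitzWith_comp_lineMap hK p q).lipschitzOnWith).absolutelyContinuousOnInterval

variable [MeasurableSpace X] [BorelSpace X]

/-- The length measure of a segment. -/
noncomputable def segmentMeasure (p q : X) : Measure X :=
  ENNReal.ofReal (dist p q) •
    (volume.restrict (Ioo (0 : ℝ) 1)).map fun t => AffineMap.lineMap p q t

instance (p q : X) : IsFiniteMeasure (segmentMeasure p q) :=
  Measure.smul_finite _ ENNReal.ofReal_ne_top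

theorem segmentMeasure_univ (p q : X) : segmentMeasure p q univ = ENNReal.ofReal (dist p q) := by
  simp [segmentMeasure, Measure.map_apply (continuous_lineMap p q).measurable MeasurableSet.univ]

/-- Only the open segment matters. This is essential for the detours, because segments issuing from
a common point are disjoint only without that point, which may be an atom of `‖T‖`. -/
theorem segmentMeasure_eq_zero {p q : X} {B : Set X} (hB : MeasurableSet B)
    (h : Disjoint B (openSegment ℝ p q)) : segmentMeasure p q B = 0 := by
  have hpre : (fun t : ℝ => (AffineMap.lineMap p q t : X)) ⁻¹' B ∩ Ioo 0 1 = ∅ := by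
    rw [eq_empty_iff_forall_notMem]
    rintro t ⟨htB, ht⟩
    refine disjoint_left.1 h htB ?_
    rw [openSegment_eq_image_lineMap]
    exact ⟨t, ht, rfl⟩
  rw [segmentMeasure, Measure.smul_apply, Measure.map_apply (continuous_lineMap p q).measurable hB,
    Measure.restrict_apply ((continuous_lineMap p q).measurable hB), hpre]
  simp

theorem integrableOn_mul_deriv_comp_lineMap (p q : X) (f : BddLipFun X) (π : LipFun X) :
    IntegrableOn (fun t : ℝ => f.1 (AffineMap.lineMap p q t)
      * deriv (fun s : ℝ => π.1 (AffineMap.lineMap p q s)) t) (Ioo 0 1) := by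
  obtain ⟨M, hM⟩ := f.2.2
  obtain ⟨K, hK⟩ := π.2
  refine IntegrableOn.of_bound (by simp) ?_ (M * (K * nndist p q : ℝ≥0))
    (Eventually.of_forall fun t => ?_)
  · exact (((measurable_bddLip f).comp (continuous_lineMap p q).measurable).mul
      (measurable_deriv _)).aestronglyMeasurable
  · rw [norm_mul]
    exact mul_le_mul (hM _) (norm_deriv_le_of_lipschitz (lipschitzWith_comp_lineMap hK p q))
      (norm_nonneg _) ((abs_nonneg _).trans (hM (AffineMap.lineMap p q t)))

/-- Integration of metric forms along a segment. -/
noncomputable def segmentForm (p q : X) : BddLipFun X →ₗ[ℝ] LipFun X →ₗ[ℝ] ℝ :=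
  LinearMap.mk₂ ℝ (fun f π => ∫ t in Ioo (0 : ℝ) 1, f.1 (AffineMap.lineMap p q t)
      * deriv (fun s : ℝ => π.1 (AffineMap.lineMap p q s)) t)
    (fun f f' π => by
      rw [← integral_add (integrableOn_mul_deriv_comp_lineMap p q f π)
        (integrableOn_mul_deriv_comp_lineMap p q f' π)]
      refine integral_congr_ae (Eventually.of_forall fun t => ?_)
      simp [add_mul])
    (fun c f π => by
      rw [← integral_smul]
      refine integral_congr_ae (Eventually.of_forall fun t => ?_)
      simp [mul_assoc])
    (fun f π π' => by
      rw [← integral_add (integrableOn_mul_deriv_comp_lineMap p q f π)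
        (integrableOn_mul_deriv_comp_lineMap p q f π')]
      refine integral_congr_ae ?_
      filter_upwards [ae_differentiableAt_comp_lineMap p q π,
        ae_differentiableAt_comp_lineMap p q π'] with t h1 h2
      rw [← mul_add, ← deriv_fun_add h1 h2]
      rfl)
    (fun c f π => by
      rw [← integral_smul]
      refine integral_congr_ae ?_
      filter_upwards [ae_differentiableAt_comp_lineMap p q π] with t h1
      rw [smul_eq_mul, mul_left_comm, ← deriv_const_mul c h1]
      rfl)

theorem segmentForm_apply (p q : X) (f : BddLipFun X) (π : LipFun X) :
    segmentForm p q f π = ∫ t in (0 : ℝ)..1, f.1 (AffineMap.lineMap p q t)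
      * deriv (fun s : ℝ => π.1 (AffineMap.lineMap p q s)) t := by
  rw [intervalIntegral_eq_setIntegral_Ioo]
  rfl

theorem controlledBy_segmentForm (p q : X) :
    ControlledBy (segmentForm p q) (segmentMeasure p q) := by
  refine controlledBy_of_enorm_le fun f π K hK => ?_
  have hmeas := (continuous_lineMap p q).measurable
  rw [segmentMeasure, lintegral_smul_measure, lintegral_map (measurable_bddLip f).enorm hmeas,
    smul_eq_mul, ← mul_assoc, ← lintegral_const_mul' _ _ (by finiteness)]
  refine (enorm_integral_le_lintegral_enorm _).trans (lintegral_mono fun t => ?_)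
  rw [enorm_mul, mul_comm]
  gcongr
  have := norm_deriv_le_of_lipschitz (x₀ := t) (lipschitzWith_comp_lineMap hK p q)
  rw [← ofReal_norm]
  refine (ENNReal.ofReal_le_ofReal this).trans (le_of_eq ?_)
  rw [NNReal.coe_mul, ENNReal.ofReal_mul K.coe_nonneg, ENNReal.ofReal_coe_nnreal, coe_nndist]

/-- The current given by integration along the oriented segment from `p` to `q`. -/
noncomputable def segmentCurrent (p q : X) : MetricCurrent X where
  toFun := segmentForm p q
  finite_mass := ⟨_, inferInstance, controlledBy_segmentForm p q⟩
  continuity f π π₀ K hK hπ := by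
    obtain ⟨L, hL⟩ := f.2.1
    have hK₀ : LipschitzWith K π₀.1 := LipschitzWith.of_dist_le_mul fun x y =>
      le_of_tendsto ((hπ x).dist (hπ y)) (Eventually.of_forall fun j => (hK j).dist_le_mul x y)
    -- The derivatives of `π j` along the segment need not converge. Integration by parts moves the
    -- derivative onto `f`, and then dominated convergence applies.
    have hparts : ∀ σ : LipFun X, LipschitzWith K σ.1 → segmentForm p q f σ
        = f.1 q * σ.1 q - f.1 p * σ.1 p - ∫ t in Ioo (0 : ℝ) 1,
          deriv (fun s : ℝ => f.1 (AffineMap.lineMap p q s)) t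
            * σ.1 (AffineMap.lineMap p q t) := by
      intro σ hσ
      rw [segmentForm_apply,
        (absolutelyContinuousOnInterval_comp_lineMap p q hL).integral_mul_deriv_eq_deriv_mul
          (absolutelyContinuousOnInterval_comp_lineMap p q hσ),
        intervalIntegral_eq_setIntegral_Ioo]
      simp
    rw [hparts π₀ hK₀]
    simp only [fun j => hparts (π j) (hK j)]
    refine (((hπ q).const_mul _).sub ((hπ p).const_mul _)).sub ?_
    obtain ⟨M, hM⟩ := (Metric.isBounded_range_of_tendsto _ (hπ p)).exists_norm_le
    have hMj : ∀ j, |(π j).1 p| ≤ M := fun j => hM _ ⟨j, rfl⟩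
    refine tendsto_integral_of_dominated_convergence
      (fun _ => (L * nndist p q : ℝ≥0) * (M + K * dist p q)) (fun j => ?_) ?_ (fun j => ?_) ?_
    · exact ((measurable_deriv _).mul
        ((hK j).continuous.comp (continuous_lineMap p q)).measurable).aestronglyMeasurable
    · exact integrable_const _
    · filter_upwards [ae_restrict_mem measurableSet_Ioo] with t ht
      rw [norm_mul]
      refine mul_le_mul (norm_deriv_le_of_lipschitz (lipschitzWith_comp_lineMap hL p q)) ?_
        (norm_nonneg _) (NNReal.coe_nonneg _)
      have h1 := (hK j).dist_le_mul (AffineMap.lineMap p q t) p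
      rw [dist_lineMap_left, Real.dist_eq, Real.norm_of_nonneg ht.1.le] at h1
      have h2 : t * dist p q ≤ dist p q := mul_le_of_le_one_left dist_nonneg ht.2.le
      have h3 := mul_le_mul_of_nonneg_left h2 K.coe_nonneg
      rw [Real.norm_eq_abs]
      calc |(π j).1 (AffineMap.lineMap p q t)|
          = |((π j).1 (AffineMap.lineMap p q t) - (π j).1 p) + (π j).1 p| := by
            rw [sub_add_cancel]
        _ ≤ |(π j).1 (AffineMap.lineMap p q t) - (π j).1 p| + |(π j).1 p| := abs_add_le _ _
        _ ≤ _ := by linarith [hMj j]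
    · exact Eventually.of_forall fun t => (hπ _).const_mul _
  locality f π h := by
    obtain ⟨U, hU, hfU, c, hc⟩ := h
    rw [segmentForm_apply]
    refine intervalIntegral.integral_zero_ae (Eventually.of_forall fun t _ => ?_)
    by_cases hf : f.1 (AffineMap.lineMap p q t) = 0
    · rw [hf, zero_mul]
    · have hmem : (AffineMap.lineMap p q t : X) ∈ U := hfU (subset_tsupport _ hf)
      have hev : (fun s : ℝ => π.1 (AffineMap.lineMap p q s)) =ᶠ[𝓝 t] fun _ => c := by
        filter_upwards [(hU.preimage (continuous_lineMap p q)).mem_nhds hmem] with s hs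
        exact hc _ hs
      rw [hev.deriv_eq, deriv_const, mul_zero]

theorem boundary_segmentCurrent (p q : X) (f : LipFun X) :
    (segmentCurrent p q).boundary f = f.1 q - f.1 p := by
  obtain ⟨K, hK⟩ := f.2
  have h := (absolutelyContinuousOnInterval_comp_lineMap p q hK).integral_deriv_eq_sub
  change segmentForm p q (BddLipFun.one X) f = _
  rw [segmentForm_apply]
  simpa [BddLipFun.one] using h

end Segment

end MetricCurrent

namespace MetricCurrent

/-! ### Null broken lines and convex hulls of neighbourhoods. -/

section Detour

variable {X : Type*} [NormedAddCommGroup X] [NormedSpace ℝ X]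

theorem measurableSet_openSegment [MeasurableSpace X] [BorelSpace X] {p q : X} (h : p ≠ q) :
    MeasurableSet (openSegment ℝ p q) := by
  rw [openSegment_eq_image_lineMap]
  exact measurableSet_Ioo.image_of_continuousOn_injOn (continuous_lineMap p q).continuousOn
    (AffineMap.lineMap_injective ℝ h).injOn

/-- Segments issuing from `p` in pairwise different directions: all but countably many of them
are null sets. -/
theorem countable_measure_openSegment_pos [MeasurableSpace X] [BorelSpace X] (μ : Measure X)
    [IsFiniteMeasure μ] {p q v : X} (hv : LinearIndependent ℝ ![q - p, v]) :
    {s : ℝ | 0 < μ (openSegment ℝ p (midpoint ℝ p q + s • v))}.Countable := by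
  rw [LinearIndependent.pair_iff] at hv
  have hz : ∀ s : ℝ, midpoint ℝ p q + s • v - p = (1 / 2 : ℝ) • (q - p) + s • v := by
    intro s
    rw [midpoint_eq_smul_add, invOf_eq_inv]
    module
  refine Measure.countable_meas_pos_of_disjoint_iUnion (fun s => measurableSet_openSegment ?_) ?_
  · intro h
    have h1 := hz s
    rw [← h, sub_self] at h1
    have := (hv (1 / 2) s h1.symm).1
    norm_num at this
  · intro s s' hss
    refine disjoint_left.2 fun x hx hx' => hss ?_
    simp only [openSegment_eq_image_lineMap] at hx hx'
    obtain ⟨t, ht, rfl⟩ := hx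
    obtain ⟨t', ht', h⟩ := hx'
    rw [AffineMap.lineMap_apply_module', AffineMap.lineMap_apply_module', add_left_inj, hz, hz] at h
    -- By independence, the coefficient of `q - p` determines the parameter on the segment, and that
    -- of `v` then determines the segment.
    have h0 : ((t' - t) / 2) • (q - p) + (t' * s' - t * s) • v = 0 := by
      rw [← sub_eq_zero.2 h]
      module
    obtain ⟨h1, h2⟩ := hv _ _ h0
    have h3 : t' = t := by linarith
    subst h3
    have h4 : t' * (s' - s) = 0 := by linarith
    rcases mul_eq_zero.1 h4 with h5 | h5
    · exact absurd h5 ht.1.ne'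
    · linarith

/-- In dimension at least two, two points can be joined by a broken line which is a null set apart
from its vertices and whose middle vertex is as close to their midpoint as desired. -/
theorem exists_detour [MeasurableSpace X] [BorelSpace X] (hdim : 2 ≤ Module.rank ℝ X)
    (μ : Measure X) [IsFiniteMeasure μ] {p q : X} (hpq : p ≠ q) {δ : ℝ} (hδ : 0 < δ) :
    ∃ z, dist z (midpoint ℝ p q) ≤ δ ∧ μ (openSegment ℝ p z) = 0 ∧ μ (openSegment ℝ z q) = 0 := by
  have hrank : 1 < Module.rank ℝ X := lt_of_lt_of_le (by norm_num) hdim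
  obtain ⟨v, hv⟩ := exists_linearIndependent_pair_of_one_lt_rank hrank (sub_ne_zero.2 hpq.symm)
  -- The second edge is viewed as issuing from `q`, with the same `v`, so that a single `s` outside
  -- two countable sets serves both edges.
  have hv' : LinearIndependent ℝ ![p - q, v] := by
    rw [LinearIndependent.pair_iff] at hv ⊢
    intro s t h
    obtain ⟨h1, h2⟩ := hv (-s) t (by rw [← h]; module)
    exact ⟨neg_eq_zero.1 h1, h2⟩
  have hc := (countable_measure_openSegment_pos μ hv).union
    (countable_measure_openSegment_pos μ hv')
  have hδ' : 0 < δ / (‖v‖ + 1) := by positivity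
  obtain ⟨s, hs, hsc⟩ := (hc.dense_compl ℝ).exists_mem_open isOpen_Ioo (nonempty_Ioo.2 hδ')
  simp only [mem_compl_iff, mem_union, mem_ofPred_eq, not_or, not_lt, nonpos_iff_eq_zero] at hs
  refine ⟨midpoint ℝ p q + s • v, ?_, hs.1, ?_⟩
  · rw [dist_eq_norm, add_sub_cancel_left, norm_smul, Real.norm_of_nonneg hsc.1.le]
    have := (lt_div_iff₀ (by positivity)).1 hsc.2
    nlinarith [hsc.1, norm_nonneg v]
  · rw [openSegment_symm, midpoint_comm]
    exact hs.2

/-- A support is closed but a convex hull need not be, so half of `ε` is spent on the closure. If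
`y` in the smaller hull is within `ε / 2` of `x`, translation by `x - y` carries the smaller hull
into the larger one. -/
theorem closure_convexHull_cthickening_subset {S : Set X} {ε : ℝ} (hε : 0 < ε) :
    closure (convexHull ℝ (Metric.cthickening (ε / 2) S))
      ⊆ convexHull ℝ (Metric.cthickening ε S) := by
  intro x hx
  obtain ⟨y, hy, hxy⟩ := Metric.mem_closure_iff.1 hx (ε / 2) (half_pos hε)
  have hconv : Convex ℝ ((fun z => (x - y) + z) ⁻¹' convexHull ℝ (Metric.cthickening ε S)) :=
    (convex_convexHull ℝ _).translate_preimage_right _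
  have hsub : Metric.cthickening (ε / 2) S
      ⊆ (fun z => (x - y) + z) ⁻¹' convexHull ℝ (Metric.cthickening ε S) := by
    intro a ha
    refine subset_convexHull ℝ _ ?_
    have h1 : x - y + a ∈ Metric.cthickening (ε / 2) (Metric.cthickening (ε / 2) S) := by
      refine Metric.mem_cthickening_of_dist_le _ a _ _ ha ?_
      rw [dist_eq_norm, add_sub_cancel_right, ← dist_eq_norm]
      exact hxy.le
    have h2 := Metric.cthickening_cthickening_subset (half_pos hε).le (half_pos hε).le S h1
    rwa [add_halves] at h2
  have := convexHull_min hsub hconv hy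
  simpa using this

/-- With `w` the displacement of `z` from the midpoint, `z` is the midpoint of `p + w` and `q + w`,
both within `δ` of `S`. -/
theorem mem_convexHull_of_dist_midpoint_le {S : Set X} {p q z : X} {δ : ℝ} (hp : p ∈ S)
    (hq : q ∈ S) (hz : dist z (midpoint ℝ p q) ≤ δ) :
    z ∈ convexHull ℝ (Metric.cthickening δ S) := by
  set w := z - midpoint ℝ p q with hw
  have hmem : ∀ x ∈ S, x + w ∈ convexHull ℝ (Metric.cthickening δ S) := fun x hx => by
    refine subset_convexHull ℝ _ (Metric.mem_cthickening_of_dist_le _ x _ _ hx ?_)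
    rw [dist_eq_norm, add_sub_cancel_left, hw, ← dist_eq_norm]
    exact hz
  have h := (convex_convexHull ℝ (Metric.cthickening δ S)).midpoint_mem (hmem p hp) (hmem q hq)
  have e : midpoint ℝ (p + w) (q + w) = z := by
    rw [hw, midpoint_eq_smul_add, midpoint_eq_smul_add, invOf_eq_inv]
    module
  rwa [e] at h

end Detour

/-! ### Filling the boundary. -/

section Filling

variable {X : Type*} [NormedAddCommGroup X] [NormedSpace ℝ X] [CompleteSpace X]
  [TopologicalSpace.SeparableSpace X] [MeasurableSpace X] [BorelSpace X]

/-- The boundary of a current bounds, up to sign, a current of almost minimal mass which is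
carried by a null set and by the convex hull of a neighbourhood of the boundary. -/
theorem exists_filling (hdim : 2 ≤ Module.rank ℝ X) (T : MetricCurrent X) {ε : ℝ} (hε : 0 < ε) :
    ∃ (R : MetricCurrent X) (ν : Measure X) (N : Set X), MeasurableSet N ∧
      ControlledBy R.toFun ν ∧ R.boundary = -T.boundary ∧
      T.massMeasure N = 0 ∧ ν Nᶜ = 0 ∧
      ν (closure (convexHull ℝ (Metric.cthickening ε T.boundarySpt)))ᶜ = 0 ∧
      ν univ ≤ T.boundaryKR + ENNReal.ofReal ε := by
  set μ := T.massMeasure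
  obtain ⟨ι, hι, a, p, q, hpq, hp, hq, hcost, hsum⟩ :=
    T.isFlat_boundary.exists_hasSum ENNReal.toReal_nonneg (half_pos hε)
  obtain ⟨δ, hδ0, hδ⟩ := ENNReal.exists_pos_sum_of_countable
    (ENNReal.ofReal_pos.2 (half_pos hε)).ne' ι
  -- A detour lengthens the segment by at most `2 * r i`, which costs at most `δ i` after weighting
  -- by `|a i|`; these costs sum to at most `ε / 2`. The minimum with `ε` keeps the vertices in the
  -- required hull.
  set r : ι → ℝ := fun i => min ε (δ i / (2 * (|a i| + 1))) with hr
  have hr0 : ∀ i, 0 < r i := fun i => by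
    have := hδ0 i
    exact lt_min hε (by positivity)
  choose z hz hz1 hz2 using fun i => exists_detour hdim μ (hpq i) (hr0 i)
  set m : ι → Measure X := fun i =>
    ENNReal.ofReal |a i| • (segmentMeasure (p i) (z i) + segmentMeasure (z i) (q i)) with hm
  have hmuniv : ∀ i, m i univ ≤ ENNReal.ofReal (|a i| * dist (p i) (q i)) + δ i := by
    intro i
    simp only [hm, Measure.smul_apply, Measure.add_apply, segmentMeasure_univ, smul_eq_mul]
    rw [← ENNReal.ofReal_add dist_nonneg dist_nonneg, ← ENNReal.ofReal_mul (abs_nonneg _),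
      ← ENNReal.ofReal_coe_nnreal, ← ENNReal.ofReal_add (by positivity) (δ i).coe_nonneg]
    refine ENNReal.ofReal_le_ofReal ?_
    have h1 := dist_triangle (p i) (midpoint ℝ (p i) (q i)) (z i)
    have h2 := dist_triangle (z i) (midpoint ℝ (p i) (q i)) (q i)
    have h3 : dist (p i) (midpoint ℝ (p i) (q i)) + dist (midpoint ℝ (p i) (q i)) (q i)
        = dist (p i) (q i) := by
      rw [dist_left_midpoint, dist_midpoint_right, Real.norm_of_nonneg (by norm_num)]
      ring
    rw [dist_comm (midpoint ℝ (p i) (q i)) (z i)] at h1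
    have h4 : r i * (2 * (|a i| + 1)) ≤ δ i :=
      (le_div_iff₀ (by positivity)).1 (min_le_right _ _)
    nlinarith [abs_nonneg (a i), hz i, hr0 i]
  have hνuniv : Measure.sum m univ ≤ T.boundaryKR + ENNReal.ofReal ε := by
    rw [Measure.sum_apply _ MeasurableSet.univ]
    calc ∑' i, m i univ ≤ ∑' i, (ENNReal.ofReal (|a i| * dist (p i) (q i)) + δ i) :=
          ENNReal.tsum_le_tsum hmuniv
      _ ≤ ENNReal.ofReal (T.boundaryKR.toReal + ε / 2) + ENNReal.ofReal (ε / 2) := by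
          rw [ENNReal.tsum_add]
          exact add_le_add hcost hδ.le
      _ = T.boundaryKR + ENNReal.ofReal ε := by
          rw [ENNReal.ofReal_add ENNReal.toReal_nonneg (half_pos hε).le,
            ENNReal.ofReal_toReal T.boundaryKR_ne_top, add_assoc,
            ← ENNReal.ofReal_add (half_pos hε).le (half_pos hε).le, add_halves]
  have hfin : IsFiniteMeasure (Measure.sum m) :=
    ⟨hνuniv.trans_lt (ENNReal.add_lt_top.2 ⟨T.boundaryKR_ne_top.lt_top, ENNReal.ofReal_lt_top⟩)⟩
  have hnull : ∀ B : Set X, MeasurableSet B → (∀ i, Disjoint B (openSegment ℝ (p i) (z i))) →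
      (∀ i, Disjoint B (openSegment ℝ (z i) (q i))) → Measure.sum m B = 0 := by
    intro B hB h1 h2
    rw [Measure.sum_apply _ hB, ENNReal.tsum_eq_zero]
    intro i
    simp [hm, segmentMeasure_eq_zero hB (h1 i), segmentMeasure_eq_zero hB (h2 i)]
  -- The paths run from `p i` to `q i`, so their boundaries are opposite to the dipoles `f (p i) - f
  -- (q i)`: this gives the minus sign in `∂R = -∂T`.
  obtain ⟨R, hR, hRsum⟩ := exists_hasSum
    (fun i => smul (a i) (add (segmentCurrent (p i) (z i)) (segmentCurrent (z i) (q i)))) m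
    (fun i => controlledBy_smul (a i) (controlledBy_add (controlledBy_segmentForm _ _)
      (controlledBy_segmentForm _ _)))
  set N := toMeasurable μ (⋃ i, (openSegment ℝ (p i) (z i) ∪ openSegment ℝ (z i) (q i))) with hN
  have hsubN : ∀ i, openSegment ℝ (p i) (z i) ∪ openSegment ℝ (z i) (q i) ⊆ N := fun i =>
    (subset_iUnion (fun i => openSegment ℝ (p i) (z i) ∪ openSegment ℝ (z i) (q i)) i).trans
      (subset_toMeasurable _ _)
  refine ⟨R, Measure.sum m, N, measurableSet_toMeasurable _ _, hR, LinearMap.ext fun f => ?_, ?_,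
    ?_, ?_, hνuniv⟩
  · refine (hRsum (BddLipFun.one X) f).unique ?_
    rw [LinearMap.neg_apply]
    refine (hsum f).neg.congr_fun fun i => ?_
    have h1 := boundary_segmentCurrent (p i) (z i) f
    have h2 := boundary_segmentCurrent (z i) (q i) f
    change a i * ((segmentCurrent (p i) (z i)).boundary f
      + (segmentCurrent (z i) (q i)).boundary f) = _
    rw [h1, h2]
    ring
  · rw [hN, measure_toMeasurable, measure_iUnion_null_iff]
    exact fun i => measure_union_null (hz1 i) (hz2 i)
  · refine hnull _ (measurableSet_toMeasurable _ _).compl (fun i => ?_) (fun i => ?_)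
    · exact disjoint_compl_left_iff_subset.2 (subset_union_left.trans (hsubN i))
    · exact disjoint_compl_left_iff_subset.2 (subset_union_right.trans (hsubN i))
  · have hW := convex_convexHull ℝ (Metric.cthickening ε T.boundarySpt)
    have hS : ∀ x ∈ T.boundarySpt, x ∈ convexHull ℝ (Metric.cthickening ε T.boundarySpt) :=
      fun x hx => subset_convexHull ℝ _ (Metric.self_subset_cthickening _ hx)
    have hzW : ∀ i, z i ∈ convexHull ℝ (Metric.cthickening ε T.boundarySpt) := fun i =>
      mem_convexHull_of_dist_midpoint_le (hp i) (hq i) ((hz i).trans (min_le_left _ _))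
    refine hnull _ isClosed_closure.measurableSet.compl (fun i => ?_) (fun i => ?_)
    · exact disjoint_compl_left_iff_subset.2
        ((hW.openSegment_subset (hS _ (hp i)) (hzW i)).trans subset_closure)
    · exact disjoint_compl_left_iff_subset.2
        ((hW.openSegment_subset (hzW i) (hS _ (hq i))).trans subset_closure)

end Filling

end MetricCurrent

/-! ### The covering theorem. -/

theorem theoremC {X : Type*} [NormedAddCommGroup X] [NormedSpace ℝ X] [CompleteSpace X]
    [TopologicalSpace.SeparableSpace X] [MeasurableSpace X] [BorelSpace X]
    (hdim : 2 ≤ Module.rank ℝ X) (T : MetricCurrent X) :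
    (∀ ε : ℝ, 0 < ε → ∃ (C : MetricCurrent X) (B : Set X) (hB : MeasurableSet B),
      C.IsCycle ∧
      T = C.restrict hB ∧
      Measure.MutuallySingular T.massMeasure (C.restrict hB.compl).massMeasure ∧
      (C.restrict hB.compl).spt ⊆ convexHull ℝ (Metric.cthickening ε T.boundarySpt) ∧
      C.mass ≤ T.mass + T.boundaryKR + ENNReal.ofReal ε) ∧
    (∀ (C : MetricCurrent X) (B : Set X) (hB : MeasurableSet B),
      C.IsCycle → T = C.restrict hB → T.mass + T.boundaryKR ≤ C.mass) := by
  refine ⟨fun ε hε => ?_, fun C B hB => T.mass_add_boundaryKR_le C hB⟩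
  -- The half of `ε` held back here absorbs the closure of the convex hull.
  obtain ⟨R, ν, N, hN, hR, hbd, hTN, hνN, hνW, hν⟩ := T.exists_filling hdim (half_pos hε)
  have hfin : IsFiniteMeasure ν :=
    ⟨hν.trans_lt (ENNReal.add_lt_top.2 ⟨T.boundaryKR_ne_top.lt_top, ENNReal.ofReal_lt_top⟩)⟩
  have hT := T.controlledBy_massMeasure
  set C := T.add R
  have hB : MeasurableSet Nᶜ := hN.compl
  -- `‖T‖` is carried by `Nᶜ` and `ν` by `N`, so the two restrictions of `T + R` separate the
  -- summands.
  have hCR : (C.restrict hB.compl).toFun = R.toFun :=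
    C.restrict_eq_of_add hB.compl hR hT (add_comm _ _) (by rwa [compl_compl])
      (by rwa [compl_compl])
  have hle : (C.restrict hB.compl).massMeasure ≤ ν := MetricCurrent.massMeasure_le _ (hCR ▸ hR)
  refine ⟨C, Nᶜ, hB, ?_, ?_, ⟨N, hN, hTN, ?_⟩, ?_, ?_⟩
  · change T.boundary + R.boundary = 0
    rw [hbd, add_neg_cancel]
  · have h := C.restrict_eq_of_add hB hT hR rfl (by rwa [compl_compl]) hνN
    exact MetricCurrent.ext_toFun fun f π => by rw [h]
  · exact le_antisymm ((hle _).trans hνN.le) zero_le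
  · refine Subset.trans ?_ (MetricCurrent.closure_convexHull_cthickening_subset hε)
    exact (Measure.support_mono hle).trans
      (Measure.support_subset_of_isClosed isClosed_closure (mem_ae_iff.2 hνW))
  · have h := C.massMeasure_le (MetricCurrent.controlledBy_add hT hR) univ
    refine h.trans ?_
    rw [Measure.add_apply, add_assoc]
    refine add_le_add le_rfl (hν.trans ?_)
    gcongr
    linarith
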